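/- Let $f\in\mathbb Z[x_1,\dots,x_n]$ ($n\ge 1$) have at most $T$ nonzero terms and all partial degrees less than $D$, where $D\ge 2$; let $k,\ell,Q,m$ be positive integers with $kT\ge 2$ and $Q\ge 2$. Consider the following procedure SparseInterp on $m$ processors. (1) Draw a prime $q\in[Q,2Q]$ and $\alpha\in(\mathbb Z/q\mathbb Z)^*$; compute $\alpha_i=\alpha^{D^i}$ for $0\le i<n$, $\lambda=kT$ and $\mu=\lceil \ell n\lg D/\lg\lambda\rceil$. (2) For $i=1,\dots,\mu$ in parallel: draw a prime $p_i\in[\lambda,2\lambda]$, compute $D_j=D^j\bmod p_i$ for $0\le j<n$, obtain $f_i=f(\alpha_0z^{D_0},\dots,\alpha_{n-1}z^{D_{n-1}})\bmod(z^{p_i}-1)\in(\mathbb Z/q\mathbb Z)[z]$, and add $(c,j,p_i)$ to a list $L$ for every nonzero coefficient $c$ of $z^j$ in $f_i$. (3) Sort $L$ in parallel by the coefficients. (4) For each distinct coefficient $c$ in $L$ in parallel, with $(d_1,r_1),\dots,(d_u,r_u)$ the exponents and primes that occur with $c$: if $u\ge\mu/2$, find the least $u'\le u$ with $\prod_{i\le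 u'}r_i\ge D^n$ and, by Chinese remaindering, the least $E\ge 0$ with $E\equiv d_i\pmod{r_i}$ for $i\le u'$; put the coefficient $c\,\alpha^{-E}\bmod q$, taken in $[-q/2,q/2]$, and the $n$ lowest $D$-adic digits of $E$ on a list $F$ (skip $c$ if $u'$ or $E$ does not exist). (5) Sort $F$ in parallel by the exponents and return it. Time is counted in bit operations. An arithmetic operation on integers (sum, difference, product, division with remainder, gcd, modular inverse, comparison), a memory access, the evaluation of the formula for $\mu$, or the draw of a random number costs $\widetilde O(b)$ for $b$ bits of operands, address and data; obtaining the image $f_i$ costs $\widetilde O(p_i\log q)$. The iterations of a parallel loop are distributed over the $m$ processors, an idle processor taking the next iteration. Modular powers are computed by repeated squaring, Chinese remaindering and $D$-adic expansion by divide and conquer, and the sorts are parallel merge sorts in which the positions are found by binary search. Then, for all random choices, the running time is $$\widetilde O(\varphi),\qquad \varphi=\log\ell+n\log D\log Q+kT\log Q+\tfrac1m\,\ell n\log D\,\bigl(n+\log D+kT\log Q\bigr).$$ Precisely, there are constants $C,c$ that depend only on the constants implied in the costs of the basic operations, such that the running time is at most $C\,\varphi\,\bigl(\log(\varphi+\min(m,\ell))\bigr)^{c}$.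 In particular it is $O(\varphi(\log\varphi)^{O(1)})$ whenever $m$ or $\ell$ is polynomially bounded in $\varphi$. -/

import Mathlib

/-!
A model of parallel bit complexity and the parallel `SparseInterp` procedure in it.

A program is an element of `Timed α`: a value together with the number of bit operations spent.
All spending happens in the primitives below (integer operations, memory accesses, random draws,
dense evaluation); sequential composition adds the times, and a parallel loop on `m` processors
takes the time of the slowest thread when every idle thread picks up the next iteration.
-/

/-- A value, and the number of bit operations that were spent to obtain it. -/
structure Timed (α : Type) where
  val : α
  time : ℕ

/-- Sequential composition: the times add up. -/
instance Timed.instMonad : Monad Timed where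
  pure a := ⟨a, 0⟩
  bind x g := ⟨(g x.val).val, x.time + (g x.val).time⟩

namespace SparseInterp

/-! ### Charges -/

/-- The constants of the cost model: an operation of soft-linear cost on `b` bits is charged
`factor * b * (size b) ^ power`, where `size b` is the length of `b` in binary. -/
structure Rate where
  factor : ℕ
  power : ℕ

/-- The soft-linear charge for `b` bits. -/
def Rate.charge (K : Rate) (b : ℕ) : ℕ := K.factor * b * (Nat.size b) ^ K.power

/-- Number of bits that store `x` (one extra bit, so that `0` is not free). -/
def bits (x : ℕ) : ℕ := Nat.size x + 1

/-- Number of bits that store a list of numbers. -/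
def bitsList (l : List ℕ) : ℕ := (l.map bits).sum + 1

/-! ### Primitive operations -/

/-- Addition. -/
def add (K : Rate) (x y : ℕ) : Timed ℕ := ⟨x + y, K.charge (bits x + bits y)⟩

/-- Subtraction (used for `y ≤ x` only). -/
def sub (K : Rate) (x y : ℕ) : Timed ℕ := ⟨x - y, K.charge (bits x + bits y)⟩

/-- Multiplication. -/
def mul (K : Rate) (x y : ℕ) : Timed ℕ := ⟨x * y, K.charge (bits x + bits y)⟩

/-- Quotient and remainder. -/
def divMod (K : Rate) (x y : ℕ) : Timed (ℕ × ℕ) := ⟨(x / y, x % y), K.charge (bits x + bits y)⟩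

/-- Greatest common divisor. -/
def gcd (K : Rate) (x y : ℕ) : Timed ℕ := ⟨Nat.gcd x y, K.charge (bits x + bits y)⟩

/-- The inverse of `x` modulo `M`, as a number below `M` (used for coprime `x`, `M` only). -/
def invMod (K : Rate) (x M : ℕ) : Timed ℕ := ⟨((x : ZMod M)⁻¹).val, K.charge (bits x + bits M)⟩

/-- Comparison. -/
def lt (K : Rate) (x y : ℕ) : Timed Bool := ⟨decide (x < y), K.charge (bits x + bits y)⟩

/-- Equality test. -/
def eq (K : Rate) (x y : ℕ) : Timed Bool := ⟨decide (x = y), K.charge (bits x + bits y)⟩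

/-- Lexicographic comparison of two keys. -/
def keyLt (K : Rate) (x y : List ℕ) : Timed Bool :=
  ⟨decide (x < y), K.charge (bitsList x + bitsList y)⟩

/-- Spend the time for handling `b` bits (random draws, output, stores). -/
def pay (K : Rate) (b : ℕ) : Timed Unit := ⟨(), K.charge b⟩

/-- Read cell `i` of an array whose entries `x` occupy `sz x` bits: the address and the content
are paid for. -/
def read {α : Type} [Inhabited α] (K : Rate) (sz : α → ℕ) (A : List α) (i : ℕ) : Timed α :=
  ⟨A.getD i default, K.charge (bits i + sz (A.getD i default))⟩

/-! ### Loops -/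

/-- A sequential loop: the times of the iterations add up. -/
def forEach {α β : Type} (l : List α) (body : α → Timed β) : Timed (List β) :=
  ⟨l.map fun a => (body a).val, (l.map fun a => (body a).time).sum⟩

/-- Given the sorted list of the times at which the threads become idle, the thread that is idle
first executes an iteration of length `t`. -/
def assign : List ℕ → ℕ → List ℕ
  | [], _ => []
  | a :: l, t => l.orderedInsert (· ≤ ·) (a + t)

/-- The time after which `m` threads have executed iterations of the given lengths, where each
thread that becomes idle takes the next iteration. -/
def makespan (m : ℕ) (ts : List ℕ) : ℕ :=
  (ts.foldl assign (List.replicate m 0)).foldr max 0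

/-- A parallel loop on `m` processors. -/
def parFor {α β : Type} (m : ℕ) (l : List α) (body : α → Timed β) : Timed (List β) :=
  ⟨l.map fun a => (body a).val, makespan m (l.map fun a => (body a).time)⟩

/-! ### Arithmetic subroutines -/

/-- `x * y mod q`. -/
def mulMod (K : Rate) (x y q : ℕ) : Timed ℕ := do
  let z ← mul K x y
  let r ← divMod K z q
  pure r.2

/-- `x ^ E mod q` by repeated squaring, from the most significant bit of `E` on. -/
def powMod (K : Rate) (x E q : ℕ) : Timed ℕ :=
  E.bits.reverse.foldlM (fun acc b => do
    let s ← mulMod K acc acc q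
    if b then mulMod K s x q else pure s) 1

/-- `x ^ E` by repeated squaring. -/
def pow (K : Rate) (x E : ℕ) : Timed ℕ :=
  E.bits.reverse.foldlM (fun acc b => do
    let s ← mul K acc acc
    if b then mul K s x else pure s) 1

/-- Combine neighbours: `[a, b, c, d, …] ↦ [op a b, op c d, …]`. -/
def pairUp {α : Type} (op : α → α → Timed α) : List α → Timed (List α)
  | a :: b :: l => do
      let c ← op a b
      let r ← pairUp op l
      pure (c :: r)
  | l => pure l

/-- Combine neighbours until at most one element is left; the first argument bounds the number of
rounds, and the length of the list is always enough. -/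
def treeRounds {α : Type} (op : α → α → Timed α) (unit : α) : ℕ → List α → Timed α
  | _, [] => pure unit
  | _, [a] => pure a
  | 0, a :: _ :: _ => pure a
  | fuel + 1, a :: b :: l => do
      let l' ← pairUp op (a :: b :: l)
      treeRounds op unit fuel l'

/-- Combine the elements of a list along a balanced binary tree. -/
def treeFold {α : Type} (op : α → α → Timed α) (unit : α) (l : List α) : Timed α :=
  treeRounds op unit l.length l

/-- Product of a list of numbers by a product tree. -/
def prodTree (K : Rate) (l : List ℕ) : Timed ℕ := treeFold (mul K) 1 l

/-- Merge the residue classes `E₁ mod M₁` and `E₂ mod M₂` into one class modulo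
`lcm M₁ M₂`; the result is `none` if they are disjoint. -/
def crtMerge (K : Rate) : Option (ℕ × ℕ) → Option (ℕ × ℕ) → Timed (Option (ℕ × ℕ))
  | some (E₁, M₁), some (E₂, M₂) => do
      let g ← gcd K M₁ M₂
      let r₁ ← divMod K E₁ g
      let r₂ ← divMod K E₂ g
      let same ← eq K r₁.2 r₂.2
      if same then
        let M₁' ← divMod K M₁ g
        let M₂' ← divMod K M₂ g
        let i ← invMod K M₁'.1 M₂'.1
        let back ← lt K E₂ E₁
        let t ← (if back then do
            let d ← sub K E₁ E₂
            let a ← divMod K d g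
            let b ← divMod K a.1 M₂'.1
            sub K M₂'.1 b.2
          else do
            let d ← sub K E₂ E₁
            let a ← divMod K d g
            pure a.1)
        let s ← mulMod K t i M₂'.1
        let x ← mul K M₁ s
        let E ← add K E₁ x
        let M ← mul K M₁ M₂'.1
        pure (some (E, M))
      else pure none
  | _, _ => pure none

/-- Chinese remaindering: the least natural number in all the residue classes `d mod p` of the
list (with `d < p`), together with the least common multiple of the moduli, if the classes have a
common element. -/
def crt (K : Rate) (l : List (ℕ × ℕ)) : Timed (Option (ℕ × ℕ)) :=
  treeFold (crtMerge K) (some (0, 1)) (l.map some)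

/-- The `n` lowest `D`-adic digits of `E`, lowest first, by divide and conquer; the first argument
bounds the depth of the recursion, and `n` is always enough. -/
def digitsAux (K : Rate) (D : ℕ) : ℕ → ℕ → ℕ → Timed (List ℕ)
  | 0, _, _ => pure []
  | _ + 1, 0, _ => pure []
  | _ + 1, 1, E => do
      let r ← divMod K E D
      pure [r.2]
  | fuel + 1, n + 2, E => do
      let h := (n + 2) / 2
      let P ← pow K D h
      let r ← divMod K E P
      let lo ← digitsAux K D fuel h r.2
      let hi ← digitsAux K D fuel (n + 2 - h) r.1
      pure (lo ++ hi)

/-- The `n` lowest `D`-adic digits of `E`. -/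
def digits (K : Rate) (D n E : ℕ) : Timed (List ℕ) := digitsAux K D n n E

/-! ### Searching and sorting -/

/-- Binary search with at most the given number of steps. -/
def searchAux (K : Rate) (test : ℕ → Timed Bool) : ℕ → ℕ → ℕ → Timed ℕ
  | 0, lo, _ => pure lo
  | fuel + 1, lo, hi => do
      let go ← lt K lo hi
      if go then
        let s ← add K lo hi
        let mid ← divMod K s 2
        let t ← test mid.1
        if t then
          let lo' ← add K mid.1 1
          searchAux K test fuel lo' hi
        else searchAux K test fuel lo mid.1
      else pure lo

/-- Binary search: the first index in `[lo, hi)` at which a test fails that holds on an initial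
segment of this interval, and `hi` if there is none. -/
def search (K : Rate) (test : ℕ → Timed Bool) (lo hi : ℕ) : Timed ℕ :=
  searchAux K test (Nat.size (hi - lo)) lo hi

/-- The array `A` consists of consecutive sorted blocks of length `w` (the last one may be
shorter). The position of entry `i` after each even-numbered block is merged with the block that
follows it, together with the entry: its offset in its own block plus its rank in the other
block. -/
def mergePos {α : Type} [Inhabited α] (K : Rate) (key : α → List ℕ) (sz : α → ℕ) (w : ℕ)
    (A : List α) (i : ℕ) : Timed (ℕ × α) := do
  let x ← read K sz A i
  let b ← divMod K i w
  let start ← sub K i b.2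
  let par ← divMod K b.1 2
  let even ← eq K par.2 0
  let pos ← (if even then do
      let lo ← add K start w
      let hi ← add K lo w
      let loOut ← lt K A.length lo
      let hiOut ← lt K A.length hi
      let lo := if loOut then A.length else lo
      let hi := if hiOut then A.length else hi
      let r ← search K (fun j => do
        let y ← read K sz A j
        keyLt K (key y) (key x)) lo hi
      let rank ← sub K r lo
      add K i rank
    else do
      let lo ← sub K start w
      let r ← search K (fun j => do
        let y ← read K sz A j
        let less ← keyLt K (key x) (key y)
        pure (!less)) lo start
      add K r b.2)
  pay K (bits pos + sz x)
  pure (pos, x)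

/-- One round of parallel merge sort: all entries move to their new positions in parallel. -/
def mergeRound {α : Type} [Inhabited α] (K : Rate) (m : ℕ) (key : α → List ℕ) (sz : α → ℕ)
    (w : ℕ) (A : List α) : Timed (List α) := do
  let moves ← parFor m (List.range A.length) (mergePos K key sz w A)
  pure (moves.foldl (fun B v => B.set v.1 v.2) A)

/-- Parallel merge sort of an array by the lexicographic order of the keys. -/
def parSort {α : Type} [Inhabited α] (K : Rate) (m : ℕ) (key : α → List ℕ) (sz : α → ℕ)
    (A : List α) : Timed (List α) := do
  let r ← (List.range (Nat.clog 2 A.length)).foldlM (fun (s : ℕ × List α) _ => do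
    let B ← mergeRound K m key sz s.1 s.2
    let w ← mul K 2 s.1
    pure (w, B)) (1, A)
  pure r.2

/-! ### The procedure -/

/-- The random choices: the prime `q`, the element `α`, and the primes `p i`. -/
structure Choices where
  q : ℕ
  α : ℕ
  p : ℕ → ℕ

/-- `q` is a prime in `[Q, 2Q]`, `α` represents a unit modulo `q`, and the `p i` are primes in
`[lam, 2 lam]`. -/
structure Choices.Valid (ω : Choices) (Q lam : ℕ) : Prop where
  q_prime : ω.q.Prime
  q_lower : Q ≤ ω.q
  q_upper : ω.q ≤ 2 * Q
  α_pos : 0 < ω.α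
  α_lt : ω.α < ω.q
  p_prime : ∀ i, (ω.p i).Prime
  p_lower : ∀ i, lam ≤ ω.p i
  p_upper : ∀ i, ω.p i ≤ 2 * lam

/-- The number `⌈(ℓ n lg D) / lg lam⌉` of images. -/
noncomputable def numImages (ℓ n D lam : ℕ) : ℕ :=
  ⌈((ℓ : ℝ) * n * Real.logb 2 D) / Real.logb 2 lam⌉₊

/-- The coefficients of `f(a₀ z ^ d₀, …, aₙ₋₁ z ^ dₙ₋₁) mod (z ^ p - 1)` over `ℤ/qℤ`, by dense
polynomial arithmetic, at a cost that is soft-linear in the size of the image. -/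
noncomputable def evalImage (K : Rate) {n : ℕ} (f : MvPolynomial (Fin n) ℤ) (q p : ℕ)
    (a d : List ℕ) : Timed (List ℕ) :=
  let g : Polynomial (ZMod q) :=
    (MvPolynomial.aeval (fun i : Fin n =>
      Polynomial.C ((a.getD i 0 : ℕ) : ZMod q) * Polynomial.X ^ (d.getD i 0)) f) %ₘ
      (Polynomial.X ^ p - 1)
  ⟨(List.range p).map fun j => (g.coeff j).val, K.charge (p * bits q)⟩

/-- A triple of a coefficient, an exponent and a prime. -/
structure Image where
  coeff : ℕ
  expo : ℕ
  prime : ℕ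

instance Image.instInhabited : Inhabited Image := ⟨⟨0, 0, 0⟩⟩

/-- Storage of a triple. -/
def Image.size (t : Image) : ℕ := bits t.coeff + bits t.expo + bits t.prime

/-- Storage of a coefficient with its exponent tuple. -/
def termSize (t : ℤ × List ℕ) : ℕ := bits t.1.natAbs + bitsList t.2 + 1

/-- `(x, x ^ D mod q, …, x ^ (D ^ (n - 1)) mod q)`. -/
def alphaPowers (K : Rate) (x D q n : ℕ) : Timed (List ℕ) := do
  let r ← (List.range (n - 1)).foldlM (fun (s : ℕ × List ℕ) _ => do
    let y ← powMod K s.1 D q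
    pure (y, s.2 ++ [y])) (x, [x])
  pure r.2

/-- `(1, D mod p, …, D ^ (n - 1) mod p)`. -/
def degreePowers (K : Rate) (D p n : ℕ) : Timed (List ℕ) := do
  let d ← divMod K D p
  let r ← (List.range (n - 1)).foldlM (fun (s : ℕ × List ℕ) _ => do
    let y ← mulMod K s.1 d.2 p
    pure (y, s.2 ++ [y])) (1, [1])
  pure r.2

/-- An iteration of the first loop: choose a prime, compute an image, list its nonzero terms. -/
noncomputable def imageStep (K : Rate) {n : ℕ} (f : MvPolynomial (Fin n) ℤ) (D : ℕ)
    (ω : Choices) (alphas : List ℕ) (i : ℕ) : Timed (List Image) := do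
  pay K (bits i)
  let p := ω.p i
  pay K (bits p)
  let ds ← degreePowers K D p n
  let fi ← evalImage K f ω.q p alphas ds
  let found ← forEach (List.range p) fun j => do
    let c ← read K bits fi j
    let zero ← eq K c 0
    if zero then pure []
    else do
      pay K (Image.size ⟨c, j, p⟩)
      pure [(⟨c, j, p⟩ : Image)]
  pure found.flatten

/-- The entries `s, s + 1, …, s + w - 1` of the array `L`. -/
def readRun (K : Rate) (L : List Image) (s w : ℕ) : Timed (List Image) :=
  forEach (List.range w) fun i => do
    let j ← add K s i
    read K Image.size L j

/-- Number of entries of the sorted array `L` that have coefficient `c`, if the first of them is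
entry `s`. -/
def runLength (K : Rate) (L : List Image) (c s : ℕ) : Timed ℕ := do
  let e ← search K (fun j => do
    let y ← read K Image.size L j
    eq K y.coeff c) s L.length
  sub K e s

/-- Product of the primes in the entries `s, …, s + w - 1`. -/
def runProduct (K : Rate) (L : List Image) (s w : ℕ) : Timed ℕ := do
  let run ← readRun K L s w
  prodTree K (run.map Image.prime)

/-- From the coefficient `c` and the exponent `E` in the diversified univariate polynomial to the
term of `f`: the coefficient `c * α⁻ᴱ mod q`, as an integer in `[-q/2, q/2]`, and the `D`-adic
digits of `E`. -/
def recoverTerm (K : Rate) (n D q α c E : ℕ) : Timed (ℤ × List ℕ) := do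
  let β ← invMod K α q
  let b ← powMod K β E q
  let r ← mulMod K c b q
  let twice ← mul K 2 r
  let big ← lt K q twice
  let c' ← (if big then do
      let s ← sub K q r
      pure (-(s : ℤ))
    else pure (r : ℤ))
  let es ← digits K D n E
  pay K (termSize (c', es))
  pure (c', es)

/-- An iteration of the second loop, for the coefficient of entry `s` of the sorted array `L`;
nothing is done unless this is the first entry with this coefficient. Nothing is added either if
no product of the primes of the run reaches `Dn`, or if the congruences have no solution. -/
def termStep (K : Rate) (n D mu Dn q α : ℕ) (L : List Image) (s : ℕ) :
    Timed (List (ℤ × List ℕ)) := do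
  let x ← read K Image.size L s
  let first ← eq K s 0
  let repeated ← (if first then pure false
    else do
      let s' ← sub K s 1
      let y ← read K Image.size L s'
      eq K y.coeff x.coeff)
  if repeated then pure []
  else do
    let u ← runLength K L x.coeff s
    let twice ← mul K 2 u
    let few ← lt K twice mu
    if few then pure []
    else do
      -- as primes are at least 2, the least admissible length is at most `n * Nat.size D`
      let most ← mul K n (Nat.size D)
      let long ← lt K most u
      let hi := if long then most else u
      let u' ← search K (fun w => do
        let P ← runProduct K L s w
        lt K P Dn) 0 hi
      let P ← runProduct K L s u'
      let small ← lt K P Dn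
      if small then pure []
      else do
        let run ← readRun K L s u'
        let sol ← crt K (run.map fun t => (t.expo, t.prime))
        match sol with
        | none => pure []
        | some (E, _) => do
            let t ← recoverTerm K n D q α x.coeff E
            pure [t]

/-- The procedure `SparseInterp` on `m` processors, for the given random choices. -/
noncomputable def sparseInterp (K : Rate) (m : ℕ) {n : ℕ} (f : MvPolynomial (Fin n) ℤ)
    (T D k ℓ : ℕ) (ω : Choices) : Timed (List (ℤ × List ℕ)) := do
  pay K (bits ω.q)
  pay K (bits ω.α)
  let alphas ← alphaPowers K ω.α D ω.q n
  let lam ← mul K k T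
  let mu := numImages ℓ n D lam
  pay K (bits ℓ + bits n + bits D + bits lam)
  let images ← parFor m (List.range mu) (imageStep K f D ω alphas)
  let L ← parSort K m (fun t => [t.coeff]) Image.size images.flatten
  let Dn ← pow K D n
  let terms ← parFor m (List.range L.length) (termStep K n D mu Dn ω.q ω.α L)
  parSort K m (fun t => t.2) termSize terms.flatten

/-- `log ℓ + n log D log Q + k T log Q + (1/m) ℓ n log D (n + log D + k T log Q)`. -/
noncomputable def costBound (n T D k ℓ Q m : ℕ) : ℝ :=
  Real.log ℓ + n * Real.log D * Real.log Q + k * T * Real.log Q +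
    (1 / (m : ℝ) * ℓ * n * Real.log D) * (n + Real.log D + k * T * Real.log Q)

end SparseInterp

/-! A charge is `b` times a power of the bit length of `b`, hence superadditive in `b`
(`Rate.charge_add_le`). The charges of consecutive steps therefore collapse into one charge for the
total number of bits, and the time analysis of each subroutine becomes linear arithmetic on bit
counts ("work").

A greedy parallel loop satisfies m · makespan ≤ (sum of the lengths) + m · (largest length)
(`mul_makespan_le`). So a loop adds its total work to the part of the bound that is divided by m,
and its longest iteration to the serial part. Write λ = kT and |x| for the bit length of x.

Images: there are μ ≤ ℓ n |D| of them, each of work n + |D| + λ|Q| up to logarithmic factors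
(`imageStep_spec`). Their triples form a list of at most 2λμ entries. Sorting it, and testing at
each entry whether a sufficiently long run starts there, costs about |Q| per entry.

Terms: reconstruction is expensive, about n|D||Q|, but is carried out only for runs of at least μ/2
entries. Such runs are disjoint intervals of the sorted list, so there are at most 4λ of them
(`card_isHeavy_le`), and their total λ n |D||Q| is within the parallel work even without the factor
ℓ. Here the time bound depends on correctness: counting runs needs the list to be really sorted, so
the merge sort is verified along the way (`BlockSorted.newPos_lt`, `parSort_spec`). A single
reconstruction stays cheap because at most n|D| primes of a run are used, because product trees and
Chinese remaindering have logarithmic depth with nonincreasing total size (`treeRounds_spec`), and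
because digit expansion is a balanced recursion (`digitsAux_time_le`).

All logarithmic factors are powers of the length of Z = nλ|D||Q|ℓ, which bounds all counts and
addresses (`mul_sparseInterp_time_le`). Every factor of Z except ℓ is at most the serial work, thus
O(φ). For ℓ there are two cases: ℓ ≤ m, where ℓ = min(m, ℓ), or m ≤ ℓ, where ℓ/m ≤ O(φ) gives ℓ =
O((φ + m)²). In both, log Z = O(log(φ + min(m, ℓ))) (`size_le_log_costBound`). -/

namespace SparseInterp

/-! ### Timed programs and charges -/

@[simp] theorem bind_val {α β : Type} (x : Timed α) (g : α → Timed β) :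
    (x >>= g).val = (g x.val).val := rfl

@[simp] theorem bind_time {α β : Type} (x : Timed α) (g : α → Timed β) :
    (x >>= g).time = x.time + (g x.val).time := rfl

@[simp] theorem pure_val {α : Type} (a : α) : (pure a : Timed α).val = a := rfl

@[simp] theorem pure_time {α : Type} (a : α) : (pure a : Timed α).time = 0 := rfl

theorem Rate.charge_mono (K : Rate) {a b : ℕ} (h : a ≤ b) : K.charge a ≤ K.charge b := by
  unfold Rate.charge
  have := Nat.size_le_size h
  gcongr

/-- The logarithmic factor is monotone, so both summands may use the one of `a + b`. -/
theorem Rate.charge_add_le (K : Rate) (a b : ℕ) :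
    K.charge a + K.charge b ≤ K.charge (a + b) := by
  unfold Rate.charge
  have ha : a.size ≤ (a + b).size := Nat.size_le_size (by omega)
  have hb : b.size ≤ (a + b).size := Nat.size_le_size (by omega)
  calc K.factor * a * a.size ^ K.power + K.factor * b * b.size ^ K.power
      ≤ K.factor * a * (a + b).size ^ K.power + K.factor * b * (a + b).size ^ K.power := by
        gcongr
    _ = _ := by ring

/-- The working form of superadditivity. Nested uses of it mirror the sequence of binds in a program
and leave a single inequality between bit counts. -/
theorem Rate.add_le_charge (K : Rate) {s t a b w : ℕ} (hs : s ≤ K.charge a) (ht : t ≤ K.charge b)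
    (h : a + b ≤ w) : s + t ≤ K.charge w :=
  (Nat.add_le_add hs ht).trans ((K.charge_add_le a b).trans (K.charge_mono h))

theorem Rate.mul_charge_le (K : Rate) (r w : ℕ) : r * K.charge w ≤ K.charge (r * w) := by
  induction r with
  | zero => simp
  | succ r ih =>
    rw [Nat.succ_mul]
    exact K.add_le_charge ih le_rfl (by rw [Nat.succ_mul])

theorem Rate.sum_le_charge (K : Rate) {α : Type} (l : List α) (t w : α → ℕ)
    (h : ∀ a ∈ l, t a ≤ K.charge (w a)) : (l.map t).sum ≤ K.charge (l.map w).sum := by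
  induction l with
  | nil => simp
  | cons a l ih =>
    simp only [List.map_cons, List.sum_cons]
    exact K.add_le_charge (h a (by simp)) (ih fun b hb => h b (by simp [hb])) le_rfl

theorem forEach_time_le (K : Rate) {α β : Type} (l : List α) (body : α → Timed β) (w : ℕ)
    (h : ∀ a ∈ l, (body a).time ≤ K.charge w) :
    (forEach l body).time ≤ K.charge (l.length * w) := by
  have := K.sum_le_charge l (fun a => (body a).time) (fun _ => w) h
  simpa [forEach] using this

/-- A loop rule. The invariant carries the number of completed iterations because some accumulators
grow with it: powers of an integer, and the block width in merge sort. -/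
theorem foldlM_spec {α β : Type} (g : β → α → Timed β) (I : ℕ → β → Prop) (t : ℕ) (l : List α)
    (b : β) (h0 : I 0 b)
    (step : ∀ i b a, i < l.length → I i b → I (i + 1) (g b a).val ∧ (g b a).time ≤ t) :
    I l.length (l.foldlM g b).val ∧ (l.foldlM g b).time ≤ l.length * t := by
  induction l generalizing b I with
  | nil => simpa using h0
  | cons a l ih =>
    obtain ⟨h1, h2⟩ := step 0 b a (by simp) h0
    obtain ⟨h3, h4⟩ := ih (fun i => I (i + 1)) (g b a).val h1
      (fun i b' a' hi hb => step (i + 1) b' a' (by simpa using hi) hb)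
    simp only [List.foldlM_cons, bind_val, bind_time, List.length_cons]
    exact ⟨h3, by rw [Nat.succ_mul]; omega⟩

/-! ### Sizes -/

theorem bits_mono {x y : ℕ} (h : x ≤ y) : bits x ≤ bits y :=
  Nat.succ_le_succ (Nat.size_le_size h)

theorem one_le_bits (x : ℕ) : 1 ≤ bits x := Nat.succ_le_succ (Nat.zero_le _)

theorem size_mul_le (x y : ℕ) : (x * y).size ≤ x.size + y.size := by
  rw [Nat.size_le, pow_add]
  exact Nat.mul_lt_mul'' (Nat.lt_size_self x) (Nat.lt_size_self y)

theorem size_add_le (x y : ℕ) : (x + y).size ≤ max x.size y.size + 1 := by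
  rw [Nat.size_le, pow_succ]
  have h1 := (Nat.lt_size_self x).trans_le
    (Nat.pow_le_pow_right (by norm_num : 0 < 2) (le_max_left x.size y.size))
  have h2 := (Nat.lt_size_self y).trans_le
    (Nat.pow_le_pow_right (by norm_num : 0 < 2) (le_max_right x.size y.size))
  omega

theorem size_pow_le (x r : ℕ) : (x ^ r).size ≤ r * x.size + 1 := by
  induction r with
  | zero => simp
  | succ r ih =>
    rw [pow_succ, Nat.succ_mul]
    have := size_mul_le (x ^ r) x
    omega

theorem bits_mul_le (x y : ℕ) : bits (x * y) ≤ bits x + bits y := by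
  have := size_mul_le x y
  unfold bits
  omega

theorem bits_two_mul_le (x : ℕ) : bits (2 * x) ≤ bits x + 1 := by
  have := size_add_le x x
  rw [two_mul]
  unfold bits
  simp at this
  omega

theorem bits_four_mul_le (x : ℕ) : bits (4 * x) ≤ bits x + 2 := by
  have h := bits_two_mul_le (2 * x)
  have := bits_two_mul_le x
  rw [← mul_assoc] at h
  norm_num at h
  omega

theorem bits_zero : bits 0 = 1 := by simp [bits]

theorem bits_one : bits 1 = 2 := by simp [bits]

theorem bits_two : bits 2 = 3 := by
  have : Nat.size 2 = 2 := by decide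
  simp [bits, this]

theorem size_le_self (x : ℕ) : x.size ≤ x := Nat.size_le.2 Nat.lt_two_pow_self

theorem two_pow_size_le {x : ℕ} (hx : 1 ≤ x) : 2 ^ x.size ≤ 2 * x := by
  obtain ⟨s, hs⟩ : ∃ s, x.size = s + 1 := ⟨x.size - 1, by have := Nat.size_pos.2 hx; omega⟩
  have := Nat.lt_size.1 (show s < x.size by omega)
  rw [hs, pow_succ]
  omega

theorem bitsList_le (l : List ℕ) (b : ℕ) (h : ∀ x ∈ l, bits x ≤ b) :
    bitsList l ≤ l.length * b + 1 := by
  have := List.sum_le_card_nsmul (l.map bits) b (by simpa using h)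
  simpa [bitsList] using this

/-! ### The makespan of a parallel loop -/

/-- The head `a` of the sorted list is the least idle time. All other times are in `[a, a + t]` by
the invariant, and so is the new time `a + c`; hence the spread remains at most `t`. No thread
waits, so the sum grows exactly by the lengths of the iterations. -/
theorem foldl_assign_spec (ts : List ℕ) (t : ℕ) (hts : ∀ x ∈ ts, x ≤ t) (l : List ℕ)
    (hl : l ≠ []) (hs : l.Pairwise (· ≤ ·)) (hb : ∀ x ∈ l, ∀ y ∈ l, x ≤ y + t) :
    (ts.foldl assign l).length = l.length ∧ (ts.foldl assign l).sum = l.sum + ts.sum ∧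
      ∀ x ∈ ts.foldl assign l, ∀ y ∈ ts.foldl assign l, x ≤ y + t := by
  induction ts generalizing l with
  | nil => simpa using hb
  | cons c ts ih =>
    obtain ⟨a, l, rfl⟩ := List.exists_cons_of_ne_nil hl
    have hperm := List.perm_orderedInsert (· ≤ ·) (a + c) l
    have hc : c ≤ t := hts c (by simp)
    rw [List.pairwise_cons] at hs
    obtain ⟨h1, h2, h3⟩ := ih (fun x hx => hts x (by simp [hx]))
      (l.orderedInsert (· ≤ ·) (a + c)) (List.ne_nil_of_length_pos (by simp [hperm.length_eq]))
      (hs.2.orderedInsert _ _) (by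
        intro x hx y hy
        rw [hperm.mem_iff, List.mem_cons] at hx hy
        have hx' : x ≤ a + t := by
          rcases hx with rfl | hx
          · omega
          · exact hb x (by simp [hx]) a (by simp)
        have hy' : a ≤ y := by
          rcases hy with rfl | hy
          · omega
          · exact hs.1 y hy
        omega)
    simp only [List.foldl_cons, assign]
    refine ⟨by rw [h1, hperm.length_eq]; simp, ?_, h3⟩
    rw [h2, hperm.sum_eq]
    simp
    omega

/-- List scheduling: at the end every one of the `m` threads has been busy until at least makespan −
t, and the busy times sum to the total work. Multiplying by `m` avoids division in `ℕ`. -/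
theorem mul_makespan_le {m : ℕ} (hm : 1 ≤ m) (ts : List ℕ) (t : ℕ) (hts : ∀ x ∈ ts, x ≤ t) :
    m * makespan m ts ≤ ts.sum + m * t := by
  obtain ⟨h1, h2, h3⟩ := foldl_assign_spec ts t hts (List.replicate m 0)
    (List.ne_nil_of_length_pos (by simp; omega)) (List.pairwise_replicate.2 (by simp))
    (by simp +contextual [List.mem_replicate])
  set l := ts.foldl assign (List.replicate m 0) with hl
  have hmax : ∀ (l' : List ℕ) (b : ℕ), (∀ x ∈ l', x ≤ b) → l'.foldr max 0 ≤ b := by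
    intro l' b
    induction l' with
    | nil => simp
    | cons a l' ih =>
      intro h
      simp only [List.foldr_cons, max_le_iff]
      exact ⟨h a (by simp), ih fun x hx => h x (by simp [hx])⟩
  have hle : ∀ y ∈ l, makespan m ts ≤ y + t := fun y hy => hmax l _ fun x hx => h3 x hx y hy
  have hsum := List.card_nsmul_le_sum l (makespan m ts - t) (fun y hy => by
    have := hle y hy
    omega)
  simp only [List.length_replicate, List.sum_replicate, smul_eq_mul, mul_zero, zero_add] at h1 h2
  rw [h1, h2, smul_eq_mul, Nat.mul_sub] at hsum
  omega

/-! ### Binary trees -/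

section Tree

variable {α : Type} (K : Rate) (op : α → α → Timed α) (unit : α) (P : α → Prop) (wt : α → ℕ)
  (c : ℕ)

/-- As weights are subadditive under `op`, the total weight does not grow in a round. The length is
halved, rounded up. -/
theorem pairUp_spec
    (hop : ∀ a b, P a → P b → P (op a b).val ∧ wt (op a b).val ≤ wt a + wt b ∧
      (op a b).time ≤ K.charge (c * (wt a + wt b)))
    (l : List α) (hl : ∀ a ∈ l, P a) :
    (∀ a ∈ (pairUp op l).val, P a) ∧ ((pairUp op l).val.map wt).sum ≤ (l.map wt).sum ∧
      (pairUp op l).time ≤ K.charge (c * (l.map wt).sum) ∧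
      2 * (pairUp op l).val.length ≤ l.length + 1 := by
  induction l using pairUp.induct with
  | case1 a b l ih =>
    obtain ⟨h1, h2, h3, h4⟩ := ih fun x hx => hl x (by simp [hx])
    obtain ⟨g1, g2, g3⟩ := hop a b (hl a (by simp)) (hl b (by simp))
    simp only [pairUp, bind_val, bind_time, pure_val, pure_time, List.mem_cons, List.map_cons,
      List.sum_cons, List.length_cons]
    refine ⟨?_, by omega, ?_, by omega⟩
    · rintro x (rfl | hx)
      · exact g1
      · exact h1 x hx
    · exact K.add_le_charge g3 h3 (by rw [← mul_add, add_assoc])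
  | case2 l hl' =>
    have : pairUp op l = pure l := by
      match l, hl' with
      | [], _ => rfl
      | [a], _ => rfl
      | a :: b :: l, h => exact absurd rfl (h a b l)
    rw [this]
    refine ⟨hl, le_rfl, by simp, ?_⟩
    match l, hl' with
    | [], _ => simp
    | [a], _ => simp
    | a :: b :: l, h => exact absurd rfl (h a b l)

/-- Each of the at most `d` rounds is charged for the initial total weight. The summand `wt unit` is
there for the empty list. -/
theorem treeRounds_spec (hunit : P unit)
    (hop : ∀ a b, P a → P b → P (op a b).val ∧ wt (op a b).val ≤ wt a + wt b ∧
      (op a b).time ≤ K.charge (c * (wt a + wt b)))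
    (fuel : ℕ) (l : List α) (hl : ∀ a ∈ l, P a) (d : ℕ) (hd : l.length ≤ 2 ^ d) :
    P (treeRounds op unit fuel l).val ∧
      wt (treeRounds op unit fuel l).val ≤ (l.map wt).sum + wt unit ∧
      (treeRounds op unit fuel l).time ≤ K.charge (d * (c * (l.map wt).sum)) := by
  induction fuel generalizing l d with
  | zero =>
    match l with
    | [] => exact ⟨hunit, by simp [treeRounds], by simp [treeRounds]⟩
    | [a] => exact ⟨hl a (by simp), by simp [treeRounds], by simp [treeRounds]⟩
    | a :: b :: l =>
      -- Out of fuel, the first element is returned for free and meets all three bounds, so `fuel`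
      -- need not be related to the length.
      exact ⟨hl a (by simp), by simp [treeRounds]; omega, by simp [treeRounds]⟩
  | succ fuel ih =>
    match l with
    | [] => exact ⟨hunit, by simp [treeRounds], by simp [treeRounds]⟩
    | [a] => exact ⟨hl a (by simp), by simp [treeRounds], by simp [treeRounds]⟩
    | a :: b :: l =>
      obtain ⟨h1, h2, h3, h4⟩ := pairUp_spec K op P wt c hop (a :: b :: l) hl
      obtain ⟨d, rfl⟩ : ∃ e, d = e + 1 := by
        cases d with
        | zero => simp at hd
        | succ d => exact ⟨d, rfl⟩
      obtain ⟨g1, g2, g3⟩ := ih _ h1 d (by rw [pow_succ] at hd; omega)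
      simp only [treeRounds, bind_val, bind_time]
      refine ⟨g1, by omega, K.add_le_charge h3 g3 ?_⟩
      calc _ ≤ c * ((a :: b :: l).map wt).sum + d * (c * ((a :: b :: l).map wt).sum) := by gcongr
        _ = _ := by ring

theorem treeFold_spec (hunit : P unit)
    (hop : ∀ a b, P a → P b → P (op a b).val ∧ wt (op a b).val ≤ wt a + wt b ∧
      (op a b).time ≤ K.charge (c * (wt a + wt b)))
    (l : List α) (hl : ∀ a ∈ l, P a) :
    P (treeFold op unit l).val ∧
      wt (treeFold op unit l).val ≤ (l.map wt).sum + wt unit ∧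
      (treeFold op unit l).time ≤ K.charge (l.length.size * (c * (l.map wt).sum)) :=
  treeRounds_spec K op unit P wt c hunit hop _ l hl _ (Nat.lt_size_self _).le

end Tree

/-! ### Binary search -/

theorem searchAux_mem (K : Rate) (test : ℕ → Timed Bool) (fuel lo hi : ℕ) (hlo : lo ≤ hi) :
    lo ≤ (searchAux K test fuel lo hi).val ∧ (searchAux K test fuel lo hi).val ≤ hi := by
  induction fuel generalizing lo hi with
  | zero => simp [searchAux, hlo]
  | succ fuel ih =>
    rw [searchAux]
    by_cases h : lo < hi
    · have h1 := ih lo ((lo + hi) / 2) (by omega)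
      have h2 := ih ((lo + hi) / 2 + 1) hi (by omega)
      cases hv : (test ((lo + hi) / 2)).val <;> simp [lt, add, divMod, h, hv] <;> omega
    · simp [lt, h, hlo]

/-- The interval only shrinks, so `hi` bounds the indices in every step. No monotonicity of the test
is needed for the time. -/
theorem searchAux_time_le (K : Rate) (test : ℕ → Timed Bool) (fuel lo hi c : ℕ) (hlo : lo ≤ hi)
    (hc : ∀ j, lo ≤ j → j < hi → (test j).time ≤ K.charge c) :
    (searchAux K test fuel lo hi).time ≤ K.charge (fuel * (12 * bits hi + c)) := by
  induction fuel generalizing lo hi with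
  | zero => simp [searchAux]
  | succ fuel ih =>
    by_cases h : lo < hi
    · have hm : (lo + hi) / 2 < hi := by omega
      have hm' : lo ≤ (lo + hi) / 2 := by omega
      have b1 := bits_mono hlo
      have b2 : bits (lo + hi) ≤ bits hi + 1 := (bits_mono (by omega)).trans (bits_two_mul_le hi)
      have b3 := bits_mono hm.le
      have b4 := one_le_bits hi
      have hlt : ∀ x y : ℕ, (lt K x y).time = K.charge (bits x + bits y) := fun _ _ => rfl
      have hadd : ∀ x y : ℕ, (add K x y).time = K.charge (bits x + bits y) := fun _ _ => rfl
      have hdiv : ∀ x y : ℕ, (divMod K x y).time = K.charge (bits x + bits y) := fun _ _ => rfl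
      have e1 : (lt K lo hi).val = true := by simp [lt, h]
      have e2 : (add K lo hi).val = lo + hi := rfl
      have e3 : (divMod K (lo + hi) 2).val.1 = (lo + hi) / 2 := rfl
      have e4 : (add K ((lo + hi) / 2) 1).val = (lo + hi) / 2 + 1 := rfl
      have ht := hc _ hm' hm
      rw [searchAux]
      simp only [bind_time, e1, e2, e3, if_true, hlt, hadd, hdiv]
      cases hv : (test ((lo + hi) / 2)).val
      · have h3 := ih lo ((lo + hi) / 2) hm' fun j hj hj' => hc j hj (by omega)
        simp only [Bool.false_eq_true, if_false]
        refine K.add_le_charge le_rfl (K.add_le_charge le_rfl (K.add_le_charge le_rfl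
          (K.add_le_charge ht h3 le_rfl) le_rfl) le_rfl) ?_
        have : fuel * (12 * bits ((lo + hi) / 2) + c) ≤ fuel * (12 * bits hi + c) := by gcongr
        rw [add_one_mul fuel, bits_two]
        omega
      · have h3 := ih ((lo + hi) / 2 + 1) hi hm fun j hj hj' => hc j (by omega) hj'
        simp only [if_true, bind_time, e4, hadd]
        refine K.add_le_charge le_rfl (K.add_le_charge le_rfl
          (K.add_le_charge le_rfl
          (K.add_le_charge ht (K.add_le_charge le_rfl h3 le_rfl) le_rfl) le_rfl) le_rfl) ?_
        rw [add_one_mul fuel, bits_two, bits_one]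
        omega
    · have e1 : (lt K lo hi).val = false := by simp [lt]; omega
      have e2 : (lt K lo hi).time = K.charge (bits lo + bits hi) := rfl
      rw [searchAux]
      simp only [bind_time, e1, e2, Bool.false_eq_true, if_false, pure_time]
      refine K.charge_mono ?_
      have := bits_mono hlo
      rw [add_one_mul fuel]
      omega

theorem searchAux_val (K : Rate) (test : ℕ → Timed Bool) (fuel lo hi : ℕ) (hlo : lo ≤ hi)
    (hf : hi - lo < 2 ^ fuel)
    (hmono : ∀ i j, lo ≤ i → i ≤ j → j < hi → (test j).val = true → (test i).val = true) :
    (∀ j, lo ≤ j → j < (searchAux K test fuel lo hi).val → (test j).val = true) ∧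
      ∀ j, (searchAux K test fuel lo hi).val ≤ j → j < hi → (test j).val = false := by
  induction fuel generalizing lo hi with
  | zero =>
    have : lo = hi := by simp at hf; omega
    subst this
    simp only [searchAux, pure_val]
    exact ⟨fun j _ _ => by omega, fun j _ _ => by omega⟩
  | succ fuel ih =>
    rw [pow_succ] at hf
    by_cases h : lo < hi
    · have hm : (lo + hi) / 2 < hi := by omega
      have hm' : lo ≤ (lo + hi) / 2 := by omega
      have e1 : (lt K lo hi).val = true := by simp [lt, h]
      have e2 : (add K lo hi).val = lo + hi := rfl
      have e3 : (divMod K (lo + hi) 2).val.1 = (lo + hi) / 2 := rfl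
      have e4 : (add K ((lo + hi) / 2) 1).val = (lo + hi) / 2 + 1 := rfl
      rw [searchAux]
      simp only [bind_val, e1, e2, e3, if_true]
      cases hv : (test ((lo + hi) / 2)).val
      · obtain ⟨h1, h2⟩ := ih lo ((lo + hi) / 2) hm' (by omega)
          fun i j hi' hij hj => hmono i j hi' hij (by omega)
        simp only [Bool.false_eq_true, if_false]
        refine ⟨h1, fun j hj hj' => ?_⟩
        rcases lt_or_ge j ((lo + hi) / 2) with hlt | hge
        · exact h2 j hj hlt
        · by_contra hne
          rw [hmono _ j hm' hge hj' (by simpa using hne)] at hv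
          exact absurd hv (by simp)
      · obtain ⟨h1, h2⟩ := ih ((lo + hi) / 2 + 1) hi hm (by omega)
          fun i j hi' hij hj => hmono i j (by omega) hij hj
        simp only [if_true, bind_val, e4]
        refine ⟨fun j hj hj' => ?_, h2⟩
        rcases lt_or_ge ((lo + hi) / 2) j with hlt | hge
        · exact h1 j hlt hj'
        · exact hmono j _ hj hge hm hv
    · have e1 : (lt K lo hi).val = false := by simp [lt]; omega
      rw [searchAux]
      simp only [bind_val, e1, Bool.false_eq_true, if_false, pure_val]
      exact ⟨fun j _ _ => by omega, fun j _ _ => by omega⟩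

theorem search_mem (K : Rate) (test : ℕ → Timed Bool) {lo hi : ℕ} (hlo : lo ≤ hi) :
    lo ≤ (search K test lo hi).val ∧ (search K test lo hi).val ≤ hi :=
  searchAux_mem K test _ lo hi hlo

theorem search_time_le (K : Rate) (test : ℕ → Timed Bool) {lo hi c : ℕ} (hlo : lo ≤ hi)
    (hc : ∀ j, lo ≤ j → j < hi → (test j).time ≤ K.charge c) :
    (search K test lo hi).time ≤ K.charge (bits hi * (12 * bits hi + c)) := by
  refine (searchAux_time_le K test (Nat.size (hi - lo)) lo hi c hlo hc).trans
    (K.charge_mono (Nat.mul_le_mul_right _ ?_))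
  exact (Nat.size_le_size (Nat.sub_le hi lo)).trans (Nat.le_succ _)

/-- Correctness of the search is used for merge positions and for run lengths, and through these for
the number of coefficients that are reconstructed. -/
theorem search_val (K : Rate) (test : ℕ → Timed Bool) {lo hi : ℕ} (hlo : lo ≤ hi)
    (hmono : ∀ i j, lo ≤ i → i ≤ j → j < hi → (test j).val = true → (test i).val = true) :
    (∀ j, lo ≤ j → j < (search K test lo hi).val → (test j).val = true) ∧
      ∀ j, (search K test lo hi).val ≤ j → j < hi → (test j).val = false :=
  searchAux_val K test _ lo hi hlo (Nat.lt_size_self _) hmono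

/-! ### Arithmetic subroutines -/

section Time

variable (K : Rate) (x y : ℕ)

@[simp] theorem add_time : (add K x y).time = K.charge (bits x + bits y) := rfl
@[simp] theorem sub_time : (sub K x y).time = K.charge (bits x + bits y) := rfl
@[simp] theorem mul_time : (mul K x y).time = K.charge (bits x + bits y) := rfl
@[simp] theorem divMod_time : (divMod K x y).time = K.charge (bits x + bits y) := rfl
@[simp] theorem gcd_time : (gcd K x y).time = K.charge (bits x + bits y) := rfl
@[simp] theorem invMod_time : (invMod K x y).time = K.charge (bits x + bits y) := rfl
@[simp] theorem lt_time : (lt K x y).time = K.charge (bits x + bits y) := rfl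
@[simp] theorem eq_time : (eq K x y).time = K.charge (bits x + bits y) := rfl
@[simp] theorem pay_time : (pay K x).time = K.charge x := rfl
@[simp] theorem add_val : (add K x y).val = x + y := rfl
@[simp] theorem sub_val : (sub K x y).val = x - y := rfl
@[simp] theorem mul_val : (mul K x y).val = x * y := rfl
@[simp] theorem divMod_val : (divMod K x y).val = (x / y, x % y) := rfl
@[simp] theorem gcd_val : (gcd K x y).val = Nat.gcd x y := rfl
@[simp] theorem lt_val : (lt K x y).val = decide (x < y) := rfl
@[simp] theorem eq_val : (eq K x y).val = decide (x = y) := rfl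

@[simp] theorem keyLt_time (a b : List ℕ) :
    (keyLt K a b).time = K.charge (bitsList a + bitsList b) := rfl

@[simp] theorem read_val {α : Type} [Inhabited α] (sz : α → ℕ) (A : List α) (i : ℕ) :
    (read K sz A i).val = A.getD i default := rfl

@[simp] theorem read_time {α : Type} [Inhabited α] (sz : α → ℕ) (A : List α) (i : ℕ) :
    (read K sz A i).time = K.charge (bits i + sz (A.getD i default)) := rfl

end Time

theorem invMod_val_lt (K : Rate) (x : ℕ) {M : ℕ} (hM : 0 < M) : (invMod K x M).val < M := by
  have : NeZero M := ⟨hM.ne'⟩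
  exact ZMod.val_lt _

theorem mulMod_time_le (K : Rate) {x y q b : ℕ} (hx : bits x ≤ b) (hy : bits y ≤ b)
    (hq : bits q ≤ b) : (mulMod K x y q).time ≤ K.charge (5 * b) := by
  have := bits_mul_le x y
  simp only [mulMod, bind_time, pure_time, mul_time, divMod_time, mul_val, add_zero]
  exact K.add_le_charge le_rfl le_rfl (by omega)

theorem mulMod_val (K : Rate) (x y q : ℕ) : (mulMod K x y q).val = x * y % q := rfl

theorem powMod_spec (K : Rate) (x E : ℕ) {q : ℕ} (hq : 0 < q) (hx : x ≤ q) :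
    (powMod K x E q).val ≤ q ∧ (powMod K x E q).time ≤ K.charge (E.size * (10 * bits q)) := by
  have hmod : ∀ a b, (mulMod K a b q).val ≤ q := fun a b => (Nat.mod_lt _ hq).le
  have htime : ∀ a b, a ≤ q → b ≤ q → (mulMod K a b q).time ≤ K.charge (5 * bits q) :=
    fun a b ha hb => mulMod_time_le K (bits_mono ha) (bits_mono hb) le_rfl
  -- The invariant is `≤ q` rather than `< q`, so that the starting value 1 satisfies it for every
  -- positive `q`.
  obtain ⟨h1, h2⟩ := foldlM_spec (fun acc (b : Bool) => do
    let s ← mulMod K acc acc q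
    if b then mulMod K s x q else pure s) (fun _ a => a ≤ q) (K.charge (10 * bits q))
    E.bits.reverse 1 hq (by
      intro _ a b _ ha
      simp only [bind_val, bind_time]
      cases b
      · simp only [Bool.false_eq_true, if_false, pure_val, pure_time]
        exact ⟨hmod _ _, (htime _ _ ha ha).trans (K.charge_mono (by omega))⟩
      · simp only [if_true]
        exact ⟨hmod _ _, K.add_le_charge (htime _ _ ha ha) (htime _ _ (hmod _ _) hx)
          (by omega)⟩)
  refine ⟨h1, h2.trans ?_⟩
  rw [List.length_reverse, ← Nat.size_eq_bits_len]
  exact K.mul_charge_le _ _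

/-- After `i` bits of `E` the accumulator is at most x^(2^i − 1); the invariant `x * a ≤ x ^ 2 ^ i`
says this without subtraction. Since 2^|E| ≤ 2E, no intermediate value exceeds x^(2E). -/
theorem pow_spec (K : Rate) {x : ℕ} (hx : 1 ≤ x) (E : ℕ) :
    (pow K x E).val.size ≤ 2 * E * x.size + 1 ∧
      (pow K x E).time ≤ K.charge (E.size * (20 * (E * x.size + 1))) := by
  rcases Nat.eq_zero_or_pos E with rfl | hE
  · simp [pow]
  have hE2 := two_pow_size_le hE
  set k := E.size with hk
  have hstep : ∀ i, i < k → x ^ (2 ^ (i + 1)) ≤ x ^ (2 * E) := fun i hi =>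
    Nat.pow_le_pow_right hx ((Nat.pow_le_pow_right (by norm_num) hi).trans hE2)
  set B := bits (x ^ (2 * E)) with hB
  have hB' : B ≤ 2 * E * x.size + 2 := by
    have := size_pow_le x (2 * E)
    simp only [hB, bits]
    omega
  obtain ⟨h1, h2⟩ := foldlM_spec (fun acc (b : Bool) => do
    let s ← mul K acc acc
    if b then mul K s x else pure s) (fun i a => x * a ≤ x ^ 2 ^ i) (K.charge (4 * B))
    E.bits.reverse 1 (by simp) (by
      intro i a b hi ha
      rw [List.length_reverse, Nat.size_eq_bits_len, ← hk] at hi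
      have hax : x * (a * a * x) ≤ x ^ 2 ^ (i + 1) :=
        calc x * (a * a * x) = (x * a) * (x * a) := by ring
          _ ≤ x ^ 2 ^ i * x ^ 2 ^ i := Nat.mul_le_mul ha ha
          _ = x ^ 2 ^ (i + 1) := by rw [← pow_add, pow_succ, mul_two]
      have hle : ∀ y, y ≤ x * (a * a * x) → bits y ≤ B := fun y hy =>
        bits_mono (hy.trans (hax.trans (hstep i hi)))
      have l1 : x * (a * a) ≤ x * (a * a * x) :=
        Nat.mul_le_mul_left _ (Nat.le_mul_of_pos_right _ hx)
      have l2 : a * a ≤ x * (a * a) := Nat.le_mul_of_pos_left _ hx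
      have l3 : a ≤ a * a := Nat.le_mul_self a
      have l4 : bits x ≤ B := by
        refine bits_mono (Nat.le_self_pow (by omega) x)
      have l5 := hle (a * a) (l2.trans l1)
      have l6 := hle a (l3.trans (l2.trans l1))
      simp only [bind_val, bind_time, mul_val, mul_time]
      cases b
      · simp only [Bool.false_eq_true, if_false, pure_val, pure_time]
        exact ⟨l1.trans hax, K.charge_mono (by omega)⟩
      · simp only [if_true, mul_val, mul_time]
        exact ⟨hax, K.add_le_charge le_rfl le_rfl (by omega)⟩)
  rw [List.length_reverse, Nat.size_eq_bits_len, ← hk] at h1 h2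
  change x * (pow K x E).val ≤ _ at h1
  change (pow K x E).time ≤ _ at h2
  constructor
  · have : (pow K x E).val ≤ x ^ (2 * E) :=
      (Nat.le_mul_of_pos_left _ hx).trans (h1.trans (Nat.pow_le_pow_right hx hE2))
    exact (Nat.size_le_size this).trans (size_pow_le _ _)
  · refine h2.trans ((K.mul_charge_le _ _).trans (K.charge_mono (Nat.mul_le_mul_left _ ?_)))
    rw [mul_assoc] at hB'
    omega

theorem prodTree_spec (K : Rate) (l : List ℕ) (b : ℕ) (hl : ∀ x ∈ l, bits x ≤ b) :
    bits (prodTree K l).val ≤ l.length * b + 2 ∧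
      (prodTree K l).time ≤ K.charge (l.length.size * (l.length * b)) := by
  obtain ⟨-, h1, h2⟩ := treeFold_spec K (mul K) 1 (fun _ => True) bits 1 trivial
    (fun x y _ _ => ⟨trivial, bits_mul_le x y, by simp⟩) l (fun _ _ => trivial)
  have hs := List.sum_le_card_nsmul (l.map bits) b (by simpa using hl)
  rw [List.length_map, smul_eq_mul] at hs
  rw [bits_one] at h1
  refine ⟨h1.trans (by omega), h2.trans (K.charge_mono ?_)⟩
  rw [one_mul]
  gcongr

/-! ### Chinese remaindering -/

/-- A residue class that is represented by its least element. -/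
def ReducedClass : Option (ℕ × ℕ) → Prop
  | none => True
  | some (E, M) => E < M

/-- Storage of the modulus of a residue class. -/
def classSize : Option (ℕ × ℕ) → ℕ
  | none => 0
  | some (_, M) => bits M

/-- A reduced representative is smaller than its modulus, so the moduli alone measure the storage.
The merged modulus M₁ · (M₂/g) has at most as many bits as M₁ and M₂ together, which makes this size
a weight for the tree. The new representative E₁ + M₁s is again reduced because s < M₂/g. -/
theorem crtMerge_spec (K : Rate) (a b : Option (ℕ × ℕ)) (ha : ReducedClass a)
    (hb : ReducedClass b) :
    ReducedClass (crtMerge K a b).val ∧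
      classSize (crtMerge K a b).val ≤ classSize a + classSize b ∧
      (crtMerge K a b).time ≤ K.charge (40 * (classSize a + classSize b)) := by
  match a, b with
  | none, _ => simp [crtMerge, ReducedClass, classSize]
  | some (_, _), none => simp [crtMerge, ReducedClass, classSize]
  | some (E₁, M₁), some (E₂, M₂) =>
    simp only [ReducedClass] at ha hb
    simp only [classSize]
    set B := bits M₁ + bits M₂ with hB
    set g := Nat.gcd M₁ M₂ with hg
    have g1 : g ∣ M₁ := Nat.gcd_dvd_left _ _
    have g2 : g ∣ M₂ := Nat.gcd_dvd_right _ _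
    have gpos : 0 < g := Nat.gcd_pos_of_pos_left _ (by omega)
    have p1 := one_le_bits M₁
    have p2 := one_le_bits M₂
    have hL : ∀ {x}, x ≤ M₁ → bits x ≤ B := fun h => (bits_mono h).trans (by omega)
    have hR : ∀ {x}, x ≤ M₂ → bits x ≤ B := fun h => (bits_mono h).trans (by omega)
    have bg := hL (Nat.le_of_dvd (by omega) g1)
    have bE1 := hL ha.le
    have bE2 := hR hb.le
    have bM1 := hL (le_refl M₁)
    have bM2 := hR (le_refl M₂)
    have br1 := hL ((Nat.mod_le E₁ g).trans ha.le)
    have br2 := hR ((Nat.mod_le E₂ g).trans hb.le)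
    have bd1 := hL (Nat.div_le_self M₁ g)
    have hd2 : 0 < M₂ / g := Nat.div_pos (Nat.le_of_dvd (by omega) g2) gpos
    have hd2' := Nat.div_le_self M₂ g
    have bd2 := hR hd2'
    by_cases hsame : E₁ % g = E₂ % g
    swap
    · simp only [crtMerge, bind_val, bind_time, gcd_val, divMod_val, eq_val, gcd_time,
        divMod_time, eq_time, ← hg, hsame, decide_false, Bool.false_eq_true, if_false, pure_val,
        pure_time, add_zero]
      refine ⟨trivial, Nat.zero_le _, ?_⟩
      refine K.add_le_charge le_rfl (K.add_le_charge le_rfl (K.add_le_charge le_rfl le_rfl le_rfl)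
        le_rfl) ?_
      omega
    set i := (invMod K (M₁ / g) (M₂ / g)).val with hi
    have hi' : i < M₂ / g := invMod_val_lt K _ hd2
    have bi := hR (hi'.le.trans hd2')
    -- A natural number congruent to (E₂ − E₁)/g modulo M₂/g. The branch that avoids negative
    -- numbers is isolated, so that one bound serves both cases and the rest of the program is
    -- straight-line.
    let tt : Timed ℕ := if (lt K E₂ E₁).val then do
            let d ← sub K E₁ E₂
            let a ← divMod K d g
            let b ← divMod K a.1 (M₂ / g)
            sub K (M₂ / g) b.2
          else do
            let d ← sub K E₂ E₁
            let a ← divMod K d g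
            pure a.1
    have htt : tt.val ≤ M₂ ∧ tt.time ≤ K.charge (8 * B) := by
      by_cases hback : E₂ < E₁
      · have e : tt = (do
            let d ← sub K E₁ E₂
            let a ← divMod K d g
            let b ← divMod K a.1 (M₂ / g)
            sub K (M₂ / g) b.2) := by simp [tt, hback]
        rw [e]
        simp only [bind_val, bind_time, sub_val, divMod_val, sub_time, divMod_time]
        have b1 := hL ((Nat.sub_le E₁ E₂).trans ha.le)
        have b2 := hL ((Nat.div_le_self (E₁ - E₂) g).trans ((Nat.sub_le E₁ E₂).trans ha.le))
        have b3 := hR ((Nat.mod_lt ((E₁ - E₂) / g) hd2).le.trans hd2')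
        exact ⟨(Nat.sub_le _ _).trans hd2', K.add_le_charge le_rfl (K.add_le_charge le_rfl
          (K.add_le_charge le_rfl le_rfl le_rfl) le_rfl) (by omega)⟩
      · have e : tt = (do
            let d ← sub K E₂ E₁
            let a ← divMod K d g
            pure a.1) := by simp [tt, hback]
        rw [e]
        simp only [bind_val, bind_time, sub_val, divMod_val, sub_time, divMod_time, pure_val,
          pure_time, add_zero]
        have b1 := hR ((Nat.sub_le E₂ E₁).trans hb.le)
        exact ⟨(Nat.div_le_self _ _).trans ((Nat.sub_le _ _).trans hb.le),
          K.add_le_charge le_rfl le_rfl (by omega)⟩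
    have e : crtMerge K (some (E₁, M₁)) (some (E₂, M₂)) = (do
        let g ← gcd K M₁ M₂
        let r₁ ← divMod K E₁ g
        let r₂ ← divMod K E₂ g
        let _ ← eq K r₁.2 r₂.2
        let M₁' ← divMod K M₁ g
        let M₂' ← divMod K M₂ g
        let i ← invMod K M₁'.1 M₂'.1
        let _ ← lt K E₂ E₁
        let t ← tt
        let s ← mulMod K t i M₂'.1
        let x ← mul K M₁ s
        let E ← add K E₁ x
        let M ← mul K M₁ M₂'.1
        pure (some (E, M))) := by
      simp only [crtMerge, bind, gcd_val, divMod_val, eq_val, ← hg, hsame, decide_true, if_true,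
        tt]
    rw [e]
    have bt := hR htt.1
    have hs : tt.val * i % (M₂ / g) < M₂ / g := Nat.mod_lt _ hd2
    set s := tt.val * i % (M₂ / g) with hsdef
    have bs := hR (hs.le.trans hd2')
    have hEM : E₁ + M₁ * s < M₁ * (M₂ / g) :=
      calc E₁ + M₁ * s < M₁ + M₁ * s := by omega
        _ = M₁ * (s + 1) := by ring
        _ ≤ _ := Nat.mul_le_mul_left _ hs
    have bM : bits (M₁ * (M₂ / g)) ≤ B :=
      (bits_mul_le _ _).trans (by have := bits_mono hd2'; omega)
    have bx : bits (M₁ * s) ≤ B := (bits_mono (by omega)).trans bM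
    have tm := mulMod_time_le K bt bi bd2
    simp only [bind_val, bind_time, gcd_val, gcd_time, divMod_val, divMod_time, eq_time,
      invMod_time, lt_time, mul_val, mul_time, add_val, add_time, pure_val, pure_time, add_zero,
      mulMod_val, ← hg, ← hi, ← hsdef]
    refine ⟨hEM, bM, ?_⟩
    refine K.add_le_charge le_rfl (K.add_le_charge le_rfl (K.add_le_charge le_rfl
      (K.add_le_charge le_rfl (K.add_le_charge le_rfl (K.add_le_charge le_rfl
      (K.add_le_charge le_rfl (K.add_le_charge le_rfl (K.add_le_charge htt.2
      (K.add_le_charge tm (K.add_le_charge le_rfl (K.add_le_charge le_rfl le_rfl le_rfl) le_rfl)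
      le_rfl) le_rfl) le_rfl) le_rfl) le_rfl) le_rfl) le_rfl) le_rfl) le_rfl) ?_
    omega

theorem crt_spec (K : Rate) (l : List (ℕ × ℕ)) (b : ℕ) (hl : ∀ x ∈ l, x.1 < x.2 ∧ bits x.2 ≤ b) :
    (∀ E M, (crt K l).val = some (E, M) → bits E ≤ l.length * b + 2) ∧
      (crt K l).time ≤ K.charge (l.length.size * (40 * (l.length * b))) := by
  obtain ⟨h0, h1, h2⟩ := treeFold_spec K (crtMerge K) (some (0, 1)) ReducedClass classSize 40
    (by simp [ReducedClass]) (crtMerge_spec K) (l.map some) (by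
      intro a ha
      obtain ⟨x, hx, rfl⟩ := List.mem_map.1 ha
      exact (hl x hx).1)
  have hs := List.sum_le_card_nsmul ((l.map some).map classSize) b (by
    intro y hy
    simp only [List.map_map, List.mem_map] at hy
    obtain ⟨x, hx, rfl⟩ := hy
    exact (hl x hx).2)
  rw [List.length_map, List.length_map, smul_eq_mul] at hs
  rw [List.length_map] at h2
  constructor
  · intro E M h
    change (treeFold (crtMerge K) (some (0, 1)) (l.map some)).val = _ at h
    rw [h] at h0 h1
    simp only [ReducedClass, classSize, bits_one] at h0 h1
    exact (bits_mono h0.le).trans (h1.trans (by omega))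
  · refine h2.trans (K.charge_mono ?_)
    gcongr

/-! ### Expansion in base `D` -/

/-- The remainder is no longer than `P`, and (E/P) · P ≤ E bounds the joint length of quotient and
divisor, with one bit of loss. -/
theorem size_div_add_size_mod_le (E P : ℕ) : (E / P).size + (E % P).size ≤ E.size + 1 := by
  rcases Nat.eq_zero_or_pos (E / P) with h | h
  · rw [h]
    have := Nat.size_le_size (Nat.mod_le E P)
    simp
    omega
  have hP : 0 < P := by
    by_contra hP
    obtain rfl : P = 0 := by omega
    simp at h
  have h1 : (E % P).size ≤ P.size := Nat.size_le_size (Nat.mod_lt E hP).le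
  have h2 : 2 ^ ((E / P).size - 1 + (P.size - 1)) ≤ E := by
    rw [pow_add]
    have a1 : 2 ^ ((E / P).size - 1) ≤ E / P :=
      Nat.lt_size.1 (by have := Nat.size_pos.2 h; omega)
    have a2 : 2 ^ (P.size - 1) ≤ P := Nat.lt_size.1 (by have := Nat.size_pos.2 hP; omega)
    exact (Nat.mul_le_mul a1 a2).trans (Nat.div_mul_le_self E P)
  have h3 := Nat.lt_size.2 h2
  have := Nat.size_pos.2 h
  have := Nat.size_pos.2 hP
  omega

/-- Splitting `E` may create one extra bit. The potential `E.size + 2 * n - 1` absorbs it: the two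
halves subtract 1 each, so their potentials sum to at most that of the whole. `G` is the price per
digit for computing the powers of `D`; it stays fixed down the recursion because the length of `n`
only decreases. Each of the `d + 1` levels then costs at most six times the total. -/
theorem digitsAux_time_le (K : Rate) {D : ℕ} (hD : 1 ≤ D) (G d : ℕ) :
    ∀ fuel n E, n ≤ 2 ^ d → 1 ≤ n → n.size * (20 * (D.size + 1)) ≤ G →
      (digitsAux K D fuel n E).time ≤ K.charge ((d + 1) * (6 * (n * G + (E.size + 2 * n - 1)))) := by
  induction d with
  | zero =>
    intro fuel n E hn hn1 hG
    obtain rfl : n = 1 := by simpa using le_antisymm hn hn1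
    cases fuel with
    | zero => simp [digitsAux]
    | succ fuel =>
      simp only [digitsAux, bind_time, divMod_time, pure_time, add_zero]
      refine K.charge_mono ?_
      simp only [Nat.size_one] at hG
      simp only [bits]
      omega
  | succ d ih =>
    intro fuel n E hn hn1 hG
    match fuel, n, hn1 with
    | 0, _, _ => simp [digitsAux]
    | fuel + 1, 1, _ =>
      have hG' := hG
      simp only [Nat.size_one] at hG'
      simp only [digitsAux, bind_time, divMod_time, pure_time, add_zero]
      refine K.charge_mono ((show _ ≤ 6 * (1 * G + (E.size + 2 * 1 - 1)) from ?_).trans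
        (Nat.le_mul_of_pos_left _ (by omega)))
      simp only [bits]
      omega
    | fuel + 1, n + 2, _ =>
      set h := (n + 2) / 2 with hh
      rw [pow_succ] at hn
      have hs1 : h.size ≤ (n + 2).size := Nat.size_le_size (by omega)
      have hs2 : (n + 2 - h).size ≤ (n + 2).size := Nat.size_le_size (by omega)
      obtain ⟨hp1, hp2⟩ := pow_spec K hD h
      set P := (pow K D h).val with hP
      have t1 := ih fuel h (E % P) (by omega) (by omega)
        ((Nat.mul_le_mul_right _ hs1).trans hG)
      have t2 := ih fuel (n + 2 - h) (E / P) (by omega) (by omega)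
        ((Nat.mul_le_mul_right _ hs2).trans hG)
      have hsz := size_div_add_size_mod_le E P
      set V := (n + 2) * G + (E.size + 2 * (n + 2) - 1) with hV
      set V1 := h * G + ((E % P).size + 2 * h - 1) with hV1
      set V2 := (n + 2 - h) * G + ((E / P).size + 2 * (n + 2 - h) - 1) with hV2
      have hsum : h * G + (n + 2 - h) * G = (n + 2) * G := by
        rw [← add_mul]
        congr 1
        omega
      have hVV : V1 + V2 ≤ V := by omega
      have hpow : h.size * (20 * (h * D.size + 1)) ≤ V := by
        calc h.size * (20 * (h * D.size + 1)) ≤ (n + 2).size * (20 * (h * D.size + h)) := by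
              gcongr
              omega
          _ = h * ((n + 2).size * (20 * (D.size + 1))) := by ring
          _ ≤ h * G := by gcongr
          _ ≤ V := by omega
      have hDG : 20 * (D.size + 1) ≤ G := by
        refine le_trans ?_ hG
        exact Nat.le_mul_of_pos_left _ (Nat.size_pos.2 (by omega))
      have hPs : P.size ≤ V := by
        have : h * (20 * (D.size + 1)) ≤ h * G := by gcongr
        have e1 : h * (20 * (D.size + 1)) = 20 * (h * D.size) + 20 * h := by ring
        have e2 : 2 * h * D.size = 2 * (h * D.size) := by ring
        omega
      simp only [digitsAux, bind_time, divMod_time, divMod_val, pure_time, add_zero,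
        ← hP, ← hh]
      refine K.add_le_charge hp2 (K.add_le_charge le_rfl (K.add_le_charge t1 t2 le_rfl) le_rfl) ?_
      have e3 : (d + 1) * (6 * V1) + (d + 1) * (6 * V2) ≤ (d + 1) * (6 * V) := by
        rw [← mul_add, ← mul_add]
        gcongr
      have e4 : (d + 1 + 1) * (6 * V) = (d + 1) * (6 * V) + 6 * V := by ring
      have e5 : bits E + bits P ≤ 3 * V := by
        simp only [bits]
        omega
      omega

theorem digitsAux_val (K : Rate) {D : ℕ} (hD : 1 ≤ D) (fuel : ℕ) : ∀ n E,
    (digitsAux K D fuel n E).val.length ≤ n ∧ ∀ x ∈ (digitsAux K D fuel n E).val, x < D := by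
  induction fuel with
  | zero => simp [digitsAux]
  | succ fuel ih =>
    intro n E
    match n with
    | 0 => simp [digitsAux]
    | 1 => simpa [digitsAux] using Nat.mod_lt E hD
    | n + 2 =>
      simp only [digitsAux, bind_val, divMod_val, pure_val]
      set h := (n + 2) / 2 with hh
      set P := (pow K D h).val
      obtain ⟨h1, h2⟩ := ih h (E % P)
      obtain ⟨h3, h4⟩ := ih (n + 2 - h) (E / P)
      refine ⟨by rw [List.length_append]; omega, fun x hx => ?_⟩
      rcases List.mem_append.1 hx with hx | hx
      · exact h2 x hx
      · exact h4 x hx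

theorem digits_spec (K : Rate) {D n : ℕ} (hD : 1 ≤ D) (hn : 1 ≤ n) (E : ℕ) :
    bitsList (digits K D n E).val ≤ n * bits D + 1 ∧
      (digits K D n E).time ≤ K.charge ((n.size + 1) *
        (6 * (n * (n.size * (20 * (D.size + 1))) + (E.size + 2 * n)))) := by
  obtain ⟨h1, h2⟩ := digitsAux_val K hD n n E
  refine ⟨(bitsList_le _ (bits D) fun x hx => bits_mono (h2 x hx).le).trans (by gcongr),
    (digitsAux_time_le K hD _ _ n n E (Nat.lt_size_self n).le hn le_rfl).trans
      (K.charge_mono ?_)⟩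
  gcongr
  omega

/-! ### Parallel merge sort -/

theorem length_foldl_set {α : Type} (l : List (ℕ × α)) (B : List α) :
    (l.foldl (fun B v => B.set v.1 v.2) B).length = B.length := by
  induction l generalizing B with
  | nil => rfl
  | cons v l ih => simp [ih]

theorem mem_foldl_set {α : Type} (l : List (ℕ × α)) (B : List α) {x : α}
    (hx : x ∈ l.foldl (fun B v => B.set v.1 v.2) B) : x ∈ B ∨ ∃ v ∈ l, x = v.2 := by
  induction l generalizing B with
  | nil => exact Or.inl hx
  | cons v l ih =>
    rcases ih _ hx with h | ⟨u, hu, rfl⟩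
    · rcases List.mem_or_eq_of_mem_set h with h | h
      exacts [Or.inl h, Or.inr ⟨v, by simp, h⟩]
    · exact Or.inr ⟨u, by simp [hu], rfl⟩

section MergeSort

variable {α : Type} [Inhabited α] (K : Rate) (key : α → List ℕ) (sz : α → ℕ)

/-- The entry of an array at a given index. -/
def entry (A : List α) (i : ℕ) : α := A.getD i default

theorem getD_eq_entry (A : List α) (i : ℕ) : A.getD i default = entry A i := rfl

theorem entry_mem (A : List α) {i : ℕ} (hi : i < A.length) : entry A i ∈ A := by
  rw [entry, List.getD_eq_getElem _ _ hi]
  exact List.getElem_mem hi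

/-- All blocks of length `w` are sorted. -/
def BlockSorted (w : ℕ) (A : List α) : Prop :=
  ∀ i j, i ≤ j → j < A.length → i / w = j / w → key (entry A i) ≤ key (entry A j)

/-- Compare the key of an entry with `k`. -/
def belowTest (A : List α) (k : List ℕ) (j : ℕ) : Timed Bool := do
  let y ← read K sz A j
  keyLt K (key y) k

/-- Compare `k` with the key of an entry. -/
def notAboveTest (A : List α) (k : List ℕ) (j : ℕ) : Timed Bool := do
  let y ← read K sz A j
  let less ← keyLt K k (key y)
  pure (!less)

/-- Position of entry `i` of a block with an even number after the merge. -/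
def evenPos (w : ℕ) (A : List α) (i : ℕ) : ℕ :=
  let lo := min A.length (i - i % w + w)
  let hi := min A.length (i - i % w + w + w)
  i + ((search K (belowTest K key sz A (key (entry A i))) lo hi).val - lo)

/-- Position of entry `i` of a block with an odd number after the merge. -/
def oddPos (w : ℕ) (A : List α) (i : ℕ) : ℕ :=
  (search K (notAboveTest K key sz A (key (entry A i))) (i - i % w - w) (i - i % w)).val + i % w

theorem mergePos_val (w : ℕ) (A : List α) (i : ℕ) :
    (mergePos K key sz w A i).val =
      (if i / w % 2 = 0 then evenPos K key sz w A i else oddPos K key sz w A i, entry A i) := by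
  by_cases h : i / w % 2 = 0
  · have e1 : (if A.length < i - i % w + w then A.length else i - i % w + w) =
        min A.length (i - i % w + w) := by
      split <;> omega
    have e2 : (if A.length < i - i % w + w + w then A.length else i - i % w + w + w) =
        min A.length (i - i % w + w + w) := by
      split <;> omega
    simp [mergePos, h, evenPos, entry, e1, e2]
    rfl
  · simp [mergePos, h, oddPos, entry]
    rfl

theorem mergePos_time_le (w : ℕ) (A : List α) (Z : ℕ) (hw : w ≤ A.length)
    (hZ : ∀ x ∈ A, sz x ≤ Z) (hkey : ∀ x ∈ A, bitsList (key x) ≤ sz x) {i : ℕ}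
    (hi : i < A.length) :
    (mergePos K key sz w A i).time ≤
      K.charge (200 * (bits A.length * (bits A.length + Z))) := by
  set N := A.length with hN
  have b2 : ∀ {x}, x ≤ 2 * N → bits x ≤ 3 * bits N := fun h =>
    (bits_mono h).trans ((bits_two_mul_le N).trans (by have := one_le_bits N; omega))
  have b4 : ∀ {x}, x ≤ 4 * N → bits x ≤ 3 * bits N := fun h =>
    (bits_mono h).trans ((bits_four_mul_le N).trans (by have := one_le_bits N; omega))
  have p := one_le_bits N
  have bi : bits i ≤ bits N := bits_mono hi.le
  have bw : bits w ≤ bits N := bits_mono hw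
  have bq : bits (i / w) ≤ bits N := bits_mono ((Nat.div_le_self _ _).trans hi.le)
  have br : bits (i % w) ≤ bits N := bits_mono ((Nat.mod_le _ _).trans hi.le)
  have bpar : bits (i / w % 2) ≤ bits N :=
    bits_mono ((Nat.mod_le _ _).trans ((Nat.div_le_self _ _).trans hi.le))
  have bs : bits (i - i % w) ≤ bits N := bits_mono ((Nat.sub_le _ _).trans hi.le)
  have hx := hZ _ (entry_mem A hi)
  have hkx := hkey _ (entry_mem A hi)
  have htest1 : ∀ j, j < N → (belowTest K key sz A (key (entry A i)) j).time ≤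
      K.charge (bits N + 3 * Z) := fun j hj => by
    have h1 := hZ _ (entry_mem A hj)
    have h2 := hkey _ (entry_mem A hj)
    have h3 := bits_mono hj.le
    simp only [belowTest, bind_time, read_time, read_val, keyLt_time]
    rw [← entry]
    exact K.add_le_charge le_rfl le_rfl (by omega)
  have htest2 : ∀ j, j < N → (notAboveTest K key sz A (key (entry A i)) j).time ≤
      K.charge (bits N + 3 * Z) := fun j hj => by
    have h1 := hZ _ (entry_mem A hj)
    have h2 := hkey _ (entry_mem A hj)
    have h3 := bits_mono hj.le
    simp only [notAboveTest, bind_time, read_time, read_val, keyLt_time, pure_time, add_zero]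
    rw [← entry]
    exact K.add_le_charge le_rfl le_rfl (by omega)
  have expand : bits N * (12 * bits N + (bits N + 3 * Z)) ≤
      13 * (bits N * (bits N + Z)) := by nlinarith [Nat.zero_le (bits N * Z)]
  have hBZ : bits N + Z ≤ bits N * (bits N + Z) := Nat.le_mul_of_pos_left _ p
  have hsearch : ∀ hi', hi' ≤ N → bits hi' * (12 * bits hi' + (bits N + 3 * Z)) ≤
      13 * (bits N * (bits N + Z)) := fun hi' h => by
    have := bits_mono h
    calc _ ≤ bits N * (12 * bits N + (bits N + 3 * Z)) := by gcongr
      _ ≤ _ := expand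
  by_cases h : i / w % 2 = 0
  · have e1 : (if N < i - i % w + w then N else i - i % w + w) = min N (i - i % w + w) := by
      split <;> omega
    have e2 : (if N < i - i % w + w + w then N else i - i % w + w + w) =
        min N (i - i % w + w + w) := by
      split <;> omega
    set lo := min N (i - i % w + w) with hlo
    set hi' := min N (i - i % w + w + w) with hhi
    have hle : lo ≤ hi' := by omega
    obtain ⟨s1, s2⟩ := search_mem K (belowTest K key sz A (key (entry A i))) hle
    have s3 := search_time_le K (belowTest K key sz A (key (entry A i))) (c := bits N + 3 * Z) hle
      fun j _ hj => htest1 j (by omega)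
    set r := (search K (belowTest K key sz A (key (entry A i))) lo hi').val with hr
    have c1 : bits lo ≤ bits N := bits_mono (by omega)
    have c2 : bits r ≤ bits N := bits_mono (by omega)
    have c3 : bits (r - lo) ≤ bits N := bits_mono (by omega)
    have c4 : bits (i - i % w + w) ≤ 3 * bits N := b2 (by omega)
    have c5 : bits (i - i % w + w + w) ≤ 3 * bits N := b4 (by omega)
    have c6 : bits (i + (r - lo)) ≤ 3 * bits N := b2 (by omega)
    have c7 := hsearch hi' (by omega)
    have z0 := bits_zero
    have z2 := bits_two
    unfold belowTest at s3 hr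
    simp only [mergePos, bind_time, bind_val, read_time, read_val, divMod_val, divMod_time,
      sub_val, sub_time, eq_val, eq_time, h, decide_true, if_true, add_val, add_time, lt_val,
      lt_time, decide_eq_true_eq, ← hN, e1, e2, pay_time, pure_time, add_zero]
    simp only [getD_eq_entry] at *
    rw [← hr]
    refine K.add_le_charge le_rfl (K.add_le_charge le_rfl (K.add_le_charge le_rfl
      (K.add_le_charge le_rfl (K.add_le_charge le_rfl (K.add_le_charge (K.add_le_charge le_rfl
      (K.add_le_charge le_rfl (K.add_le_charge le_rfl (K.add_le_charge le_rfl
      (K.add_le_charge s3 (K.add_le_charge le_rfl le_rfl le_rfl) le_rfl) le_rfl) le_rfl) le_rfl)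
      le_rfl) le_rfl le_rfl) le_rfl) le_rfl) le_rfl) le_rfl) ?_
    omega
  · set st := i - i % w with hst
    set lo := st - w with hlo
    have hle : lo ≤ st := by omega
    obtain ⟨s1, s2⟩ := search_mem K (notAboveTest K key sz A (key (entry A i))) hle
    have s3 := search_time_le K (notAboveTest K key sz A (key (entry A i))) (c := bits N + 3 * Z) hle
      fun j _ hj => htest2 j (by omega)
    set r := (search K (notAboveTest K key sz A (key (entry A i))) lo st).val with hr
    have c1 : bits lo ≤ bits N := bits_mono (by omega)
    have c2 : bits r ≤ bits N := bits_mono (by omega)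
    have hm := Nat.mod_le i w
    have c6 : bits (r + i % w) ≤ 3 * bits N := b2 (by omega)
    have c7 := hsearch st (by omega)
    have z0 := bits_zero
    have z2 := bits_two
    unfold notAboveTest at s3 hr
    simp only [mergePos, bind_time, bind_val, read_time, read_val, divMod_val, divMod_time,
      sub_val, sub_time, eq_val, eq_time, h, decide_false, Bool.false_eq_true, if_false, add_val,
      add_time, ← hst, ← hlo, pay_time, pure_time, add_zero]
    simp only [getD_eq_entry] at *
    rw [← hr]
    refine K.add_le_charge le_rfl (K.add_le_charge le_rfl (K.add_le_charge le_rfl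
      (K.add_le_charge le_rfl (K.add_le_charge le_rfl (K.add_le_charge (K.add_le_charge le_rfl
      (K.add_le_charge s3 le_rfl le_rfl) le_rfl) le_rfl le_rfl) le_rfl) le_rfl) le_rfl) le_rfl) ?_
    omega


/-! ### Correctness of a merge round. -/

variable {K key sz}

theorem BlockSorted.le {w : ℕ} {A : List α} (h : BlockSorted key w A) {b i j : ℕ}
    (hi : w * b ≤ i) (hij : i ≤ j) (hj : j < w * b + w) (hN : j < A.length) :
    key (entry A i) ≤ key (entry A j) := by
  have e : ∀ x, w * b ≤ x → x < w * b + w → x / w = b := fun x h1 h2 =>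
    Nat.div_eq_of_lt_le (by rwa [mul_comm]) (by rw [add_one_mul, mul_comm]; exact h2)
  exact h i j hij hN ((e i hi (by omega)).trans (e j (by omega) hj).symm)

theorem sub_mod_eq {i w b : ℕ} (h : i / w = b) : i - i % w = w * b := by
  have := Nat.div_add_mod i w
  rw [h] at this
  omega

/-- For an entry of the left block the strictly smaller keys on the right are counted, whereas an
entry of the right block counts the keys on the left that are smaller or equal. This asymmetry makes
the merge stable and keeps equal keys at different positions. -/
theorem BlockSorted.evenPos_spec {w : ℕ} {A : List α} (h : BlockSorted key w A) {e i : ℕ}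
    (hi : i / w = 2 * e) :
    ∃ r, evenPos K key sz w A i = i + (r - min A.length (w * (2 * e) + w)) ∧
      min A.length (w * (2 * e) + w) ≤ r ∧ r ≤ min A.length (w * (2 * e) + w + w) ∧
      (∀ j, min A.length (w * (2 * e) + w) ≤ j → j < r →
        key (entry A j) < key (entry A i)) ∧
      ∀ j, r ≤ j → j < min A.length (w * (2 * e) + w + w) →
        key (entry A i) ≤ key (entry A j) := by
  set x := entry A i with hx
  set lo := min A.length (w * (2 * e) + w) with hlo
  set hi' := min A.length (w * (2 * e) + w + w) with hhi
  have hlh : lo ≤ hi' := by omega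
  have hv : ∀ j, (belowTest K key sz A (key x) j).val = decide (key (entry A j) < key x) :=
    fun _ => rfl
  obtain ⟨h1, h2⟩ := search_mem K (belowTest K key sz A (key x)) hlh
  obtain ⟨h3, h4⟩ := search_val K (belowTest K key sz A (key x)) hlh (by
    intro a b ha hab hb
    simp only [hv, decide_eq_true_eq]
    intro hlt
    refine lt_of_le_of_lt (h.le (b := 2 * e + 1) ?_ hab ?_ ?_) hlt
    · rw [Nat.mul_add_one]; omega
    · rw [Nat.mul_add_one]; omega
    · omega)
  refine ⟨_, ?_, h1, h2, fun j hj hj' => by simpa [hv] using h3 j hj hj',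
    fun j hj hj' => by simpa [hv] using h4 j hj hj'⟩
  simp only [evenPos, sub_mod_eq hi, hlo, hhi, hx]

theorem BlockSorted.oddPos_spec {w : ℕ} {A : List α} (h : BlockSorted key w A) {e i : ℕ}
    (hi : i / w = 2 * e + 1) (hN : i < A.length) :
    ∃ r, oddPos K key sz w A i = r + (i - (w * (2 * e) + w)) ∧
      w * (2 * e) ≤ r ∧ r ≤ w * (2 * e) + w ∧
      (∀ j, w * (2 * e) ≤ j → j < r → key (entry A j) ≤ key (entry A i)) ∧
      ∀ j, r ≤ j → j < w * (2 * e) + w → key (entry A i) < key (entry A j) := by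
  set x := entry A i with hx
  set P := w * (2 * e) with hP
  have hst := sub_mod_eq hi
  rw [Nat.mul_add_one, ← hP] at hst
  have hmod := Nat.mod_le i w
  have hiP : P + w ≤ i := by
    have := Nat.div_mul_le_self i w
    rw [hi, mul_comm, Nat.mul_add_one, ← hP] at this
    exact this
  have hlh : P ≤ P + w := by omega
  have hv : ∀ j, (notAboveTest K key sz A (key x) j).val =
      !decide (key x < key (entry A j)) := fun _ => rfl
  obtain ⟨h1, h2⟩ := search_mem K (notAboveTest K key sz A (key x)) hlh
  obtain ⟨h3, h4⟩ := search_val K (notAboveTest K key sz A (key x)) hlh (by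
    intro a b ha hab hb
    simp only [hv, Bool.not_eq_true', decide_eq_false_iff_not, not_lt]
    exact (h.le ha hab hb (by omega)).trans)
  refine ⟨_, ?_, h1, h2, fun j hj hj' => by simpa [hv] using h3 j hj hj',
    fun j hj hj' => by simpa [hv] using h4 j hj hj'⟩
  have e2 : i % w = i - (P + w) := by omega
  simp only [oddPos, hst, Nat.add_sub_cancel, ← hx]
  rw [e2]

/-- Position of entry `i` after the merge. -/
def newPos (K : Rate) (key : α → List ℕ) (sz : α → ℕ) (w : ℕ) (A : List α) (i : ℕ) : ℕ :=
  (mergePos K key sz w A i).val.1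

theorem newPos_even {w : ℕ} {A : List α} {e i : ℕ} (hi : i / w = 2 * e) :
    newPos K key sz w A i = evenPos K key sz w A i := by
  simp [newPos, mergePos_val, hi]

theorem newPos_odd {w : ℕ} {A : List α} {e i : ℕ} (hi : i / w = 2 * e + 1) :
    newPos K key sz w A i = oddPos K key sz w A i := by
  simp [newPos, mergePos_val, hi, Nat.add_mod]

theorem block_bounds {w b i : ℕ} (hw : 0 < w) (hi : i / w = b) : w * b ≤ i ∧ i < w * b + w := by
  subst hi
  exact ⟨Nat.mul_div_le i w, Nat.lt_mul_div_succ i hw⟩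

theorem BlockSorted.newPos_mem {w : ℕ} {A : List α} (h : BlockSorted key w A) (hw : 0 < w)
    {i : ℕ} (hN : i < A.length) :
    newPos K key sz w A i < A.length ∧ newPos K key sz w A i / (2 * w) = i / (2 * w) := by
  have key' : ∀ e p, w * (2 * e) ≤ p → p < w * (2 * e) + w + w → p / (2 * w) = e :=
    fun e p h1 h2 => Nat.div_eq_of_lt_le (by linarith [show e * (2 * w) = w * (2 * e) by ring])
      (by linarith [show (e + 1) * (2 * w) = w * (2 * e) + w + w by ring])
  rcases Nat.even_or_odd' (i / w) with ⟨e, he | he⟩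
  · obtain ⟨r, h1, h2, h3, -, -⟩ := h.evenPos_spec (K := K) (sz := sz) he
    obtain ⟨b1, b2⟩ := block_bounds hw he
    rw [newPos_even he, h1, key' e i b1 (by omega)]
    exact ⟨by omega, key' e _ (by omega) (by omega)⟩
  · obtain ⟨r, h1, h2, h3, -, -⟩ := h.oddPos_spec (K := K) (sz := sz) he hN
    obtain ⟨b1, b2⟩ := block_bounds hw he
    rw [Nat.mul_add_one] at b1 b2
    rw [newPos_odd he, h1, key' e i (by omega) (by omega)]
    exact ⟨by omega, key' e _ (by omega) (by omega)⟩

/-- Inside a double block the new position is strictly increasing in the pair (key, index). Both the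
injectivity of the move and the sortedness of the result follow from this. The cases are the four
combinations of left and right block. -/
theorem BlockSorted.newPos_lt {w : ℕ} {A : List α} (h : BlockSorted key w A) (hw : 0 < w)
    {i i' : ℕ} (hN : i < A.length) (hN' : i' < A.length) (hb : i / (2 * w) = i' / (2 * w))
    (hlt : key (entry A i) < key (entry A i') ∨ key (entry A i) = key (entry A i') ∧ i < i') :
    newPos K key sz w A i < newPos K key sz w A i' := by
  rw [mul_comm, ← Nat.div_div_eq_div_mul, ← Nat.div_div_eq_div_mul] at hb
  have hle : key (entry A i) ≤ key (entry A i') := by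
    rcases hlt with hlt | ⟨he, -⟩
    exacts [hlt.le, he.le]
  have hlt' : i' ≤ i → key (entry A i) < key (entry A i') := fun hii => by
    rcases hlt with hlt | ⟨-, he⟩
    exacts [hlt, absurd he (by omega)]
  have hii : ∀ b, i / w = b → i' / w = b → i < i' := fun b h1 h2 => by
    by_contra hcon
    exact absurd (h i' i (by omega) hN (h2.trans h1.symm)) (hlt' (by omega)).not_ge
  rcases Nat.even_or_odd' (i / w) with ⟨e, he | he⟩ <;>
    rcases Nat.even_or_odd' (i' / w) with ⟨e', he' | he'⟩ <;>
    obtain rfl : e = e' := by omega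
  · obtain ⟨r, h1, h2, h3, h4, h5⟩ := h.evenPos_spec (K := K) (sz := sz) he
    obtain ⟨r', h1', h2', h3', h4', h5'⟩ := h.evenPos_spec (K := K) (sz := sz) he'
    rw [newPos_even he, newPos_even he', h1, h1']
    have := hii _ he he'
    have : r ≤ r' := by
      by_contra hcon
      exact absurd ((hle.trans (h5' r' le_rfl (by omega))).trans_lt (h4 r' h2' (by omega)))
        (lt_irrefl _)
    omega
  · obtain ⟨r, h1, h2, h3, h4, h5⟩ := h.evenPos_spec (K := K) (sz := sz) he
    obtain ⟨r', h1', h2', h3', h4', h5'⟩ := h.oddPos_spec (K := K) (sz := sz) he' hN'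
    obtain ⟨b1, b2⟩ := block_bounds hw he
    obtain ⟨b1', b2'⟩ := block_bounds hw he'
    rw [Nat.mul_add_one] at b1' b2'
    rw [newPos_even he, newPos_odd he', h1, h1']
    have : i < r' := by
      by_contra hcon
      exact absurd (hle.trans_lt (h5' i (by omega) b2)) (lt_irrefl _)
    have : r ≤ i' := by
      by_contra hcon
      exact absurd (hle.trans_lt (h4 i' (by omega) (by omega))) (lt_irrefl _)
    omega
  · obtain ⟨r, h1, h2, h3, h4, h5⟩ := h.oddPos_spec (K := K) (sz := sz) he hN
    obtain ⟨r', h1', h2', h3', h4', h5'⟩ := h.evenPos_spec (K := K) (sz := sz) he'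
    obtain ⟨b1, b2⟩ := block_bounds hw he
    obtain ⟨b1', b2'⟩ := block_bounds hw he'
    rw [Nat.mul_add_one] at b1 b2
    rw [newPos_odd he, newPos_even he', h1, h1']
    -- Here `i` lies in the right block and `i'` in the left one, so `i' ≤ i` and the tie case is
    -- excluded.
    have hk := hlt' (by omega)
    have : r ≤ i' := by
      by_contra hcon
      exact absurd (hk.trans_le (h4 i' b1' (by omega))) (lt_irrefl _)
    have : i < r' := by
      by_contra hcon
      exact absurd (hk.trans_le (h5' i (by omega) (by omega))) (lt_irrefl _)
    omega
  · obtain ⟨r, h1, h2, h3, h4, h5⟩ := h.oddPos_spec (K := K) (sz := sz) he hN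
    obtain ⟨r', h1', h2', h3', h4', h5'⟩ := h.oddPos_spec (K := K) (sz := sz) he' hN'
    obtain ⟨b1, b2⟩ := block_bounds hw he
    rw [Nat.mul_add_one] at b1 b2
    rw [newPos_odd he, newPos_odd he', h1, h1']
    have := hii _ he he'
    have : r ≤ r' := by
      by_contra hcon
      exact absurd ((h4 r' h2' (by omega)).trans hle |>.trans_lt (h5' r' le_rfl (by omega)))
        (lt_irrefl _)
    omega

theorem BlockSorted.newPos_inj {w : ℕ} {A : List α} (h : BlockSorted key w A) (hw : 0 < w)
    {i i' : ℕ} (hN : i < A.length) (hN' : i' < A.length)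
    (he : newPos K key sz w A i = newPos K key sz w A i') : i = i' := by
  by_contra hne
  have hb : i / (2 * w) = i' / (2 * w) := by
    rw [← (h.newPos_mem (K := K) (sz := sz) hw hN).2, he, (h.newPos_mem hw hN').2]
  rcases lt_trichotomy (key (entry A i)) (key (entry A i')) with hk | hk | hk
  · exact absurd he (h.newPos_lt hw hN hN' hb (Or.inl hk)).ne
  · rcases Nat.lt_or_gt_of_ne hne with hii | hii
    · exact absurd he (h.newPos_lt hw hN hN' hb (Or.inr ⟨hk, hii⟩)).ne
    · exact absurd he (h.newPos_lt hw hN' hN hb.symm (Or.inr ⟨hk.symm, hii⟩)).ne'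
  · exact absurd he (h.newPos_lt hw hN' hN hb.symm (Or.inl hk)).ne'

theorem entry_foldl_set (l : List (ℕ × α)) (B : List α) (k : ℕ) :
    entry (l.foldl (fun B v => B.set v.1 v.2) B) k = entry B k ∨
      ∃ v ∈ l, v.1 = k ∧ entry (l.foldl (fun B v => B.set v.1 v.2) B) k = v.2 := by
  induction l generalizing B with
  | nil => exact Or.inl rfl
  | cons v l ih =>
    simp only [List.foldl_cons]
    rcases ih (B.set v.1 v.2) with h | ⟨u, hu, h1, h2⟩
    · rw [h]
      by_cases hk : v.1 = k
      · by_cases hlt : k < B.length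
        · refine Or.inr ⟨v, by simp, hk, ?_⟩
          simp [entry, hk, hlt]
        · left
          rw [List.set_eq_of_length_le (by omega)]
      · left
        simp [entry, List.getElem?_set_ne hk]
    · exact Or.inr ⟨u, by simp [hu], h1, h2⟩

theorem exists_entry_foldl_set (l : List (ℕ × α)) (B : List α) {k : ℕ} (hk : k < B.length)
    (hv : ∃ v ∈ l, v.1 = k) :
    ∃ v ∈ l, v.1 = k ∧ entry (l.foldl (fun B v => B.set v.1 v.2) B) k = v.2 := by
  induction l generalizing B with
  | nil => simp at hv
  | cons v l ih =>
    simp only [List.foldl_cons]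
    by_cases htail : ∃ u ∈ l, u.1 = k
    · obtain ⟨u, hu, h1, h2⟩ := ih (B.set v.1 v.2) (by simpa using hk) htail
      exact ⟨u, by simp [hu], h1, h2⟩
    · have hvk : v.1 = k := by
        obtain ⟨u, hu, h1⟩ := hv
        rcases List.mem_cons.1 hu with rfl | hu
        exacts [h1, absurd ⟨u, hu, h1⟩ htail]
      refine ⟨v, by simp, hvk, ?_⟩
      rcases entry_foldl_set l (B.set v.1 v.2) k with h | ⟨u, hu, h1, -⟩
      · rw [h]
        simp [entry, hvk, hk]
      · exact absurd ⟨u, hu, h1⟩ htail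

theorem BlockSorted.mergeRound {w : ℕ} {A : List α} (h : BlockSorted key w A) (hw : 0 < w)
    (m : ℕ) :
    (mergeRound K m key sz w A).val.length = A.length ∧
      (∀ x ∈ (mergeRound K m key sz w A).val, x ∈ A) ∧
      BlockSorted key (2 * w) (mergeRound K m key sz w A).val := by
  set B := (SparseInterp.mergeRound K m key sz w A).val with hB
  have hBv : B = ((List.range A.length).map fun i => (mergePos K key sz w A i).val).foldl
    (fun B v => B.set v.1 v.2) A := rfl
  have hsnd : ∀ i, (mergePos K key sz w A i).val.2 = entry A i := fun i => by rw [mergePos_val]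
  have hlen : B.length = A.length := by rw [hBv, length_foldl_set]
  -- An injective self-map of a finite set is onto. Hence every cell is overwritten and nothing
  -- stale remains from `A`, in which the moves are recorded.
  have hsurj : ∀ k, k < A.length → ∃ i, i < A.length ∧ newPos K key sz w A i = k := by
    let F : Fin A.length → Fin A.length := fun i => ⟨newPos K key sz w A i, (h.newPos_mem hw i.2).1⟩
    have hF : Function.Injective F := fun i j hij =>
      Fin.ext (h.newPos_inj (K := K) (sz := sz) hw i.2 j.2 (congrArg Fin.val hij))
    intro k hk
    obtain ⟨i, hi⟩ := Finite.injective_iff_surjective.1 hF ⟨k, hk⟩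
    exact ⟨i, i.2, congrArg Fin.val hi⟩
  have hentry : ∀ k, k < A.length →
      ∃ i, i < A.length ∧ newPos K key sz w A i = k ∧ entry B k = entry A i := by
    intro k hk
    obtain ⟨i, hi, hik⟩ := hsurj k hk
    obtain ⟨v, hv, h1, h2⟩ := exists_entry_foldl_set
      ((List.range A.length).map fun i => (mergePos K key sz w A i).val) A hk
      ⟨_, List.mem_map.2 ⟨i, List.mem_range.2 hi, rfl⟩, hik⟩
    obtain ⟨j, hj, rfl⟩ := List.mem_map.1 hv
    exact ⟨j, List.mem_range.1 hj, h1, by rw [hBv, h2, hsnd]⟩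
  refine ⟨hlen, fun x hx => ?_, fun a b hab hb hblock => ?_⟩
  · rw [hBv] at hx
    rcases mem_foldl_set _ _ hx with hx | ⟨v, hv, rfl⟩
    · exact hx
    · obtain ⟨i, hi, rfl⟩ := List.mem_map.1 hv
      rw [hsnd]
      exact entry_mem A (List.mem_range.1 hi)
  · rw [hlen] at hb
    obtain ⟨i, hi, hia, hea⟩ := hentry a (by omega)
    obtain ⟨j, hj, hjb, heb⟩ := hentry b hb
    rw [hea, heb]
    by_contra hcon
    have hbl : j / (2 * w) = i / (2 * w) := by
      rw [← (h.newPos_mem (K := K) (sz := sz) hw hi).2,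
        ← (h.newPos_mem (K := K) (sz := sz) hw hj).2, hia, hjb, hblock]
    have := h.newPos_lt (K := K) (sz := sz) hw hj hi hbl (Or.inl (not_le.1 hcon))
    omega

theorem mergeRound_time_le {m : ℕ} (hm : 1 ≤ m) {w : ℕ} (A : List α) (Z : ℕ)
    (hw : w ≤ A.length) (hZ : ∀ x ∈ A, sz x ≤ Z) (hkey : ∀ x ∈ A, bitsList (key x) ≤ sz x) :
    m * (mergeRound K m key sz w A).time ≤
      (A.length + m) * K.charge (200 * (bits A.length * (bits A.length + Z))) := by
  set c := K.charge (200 * (bits A.length * (bits A.length + Z))) with hc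
  have hle : ∀ t ∈ (List.range A.length).map fun i => (mergePos K key sz w A i).time, t ≤ c := by
    intro t ht
    obtain ⟨i, hi, rfl⟩ := List.mem_map.1 ht
    exact mergePos_time_le K key sz w A Z hw hZ hkey (List.mem_range.1 hi)
  have h1 := mul_makespan_le hm _ c hle
  have h2 := List.sum_le_card_nsmul _ c hle
  rw [List.length_map, List.length_range, smul_eq_mul] at h2
  rw [add_mul]
  exact h1.trans (Nat.add_le_add_right h2 _)

/-- After `i` rounds the blocks of length 2^i are sorted, and 2^⌈lg N⌉ ≥ N leaves a single block. A
round takes (N + m)c/m for the moves and at most `c` for doubling the width, which explains the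
summand 2m. -/
theorem parSort_spec (K : Rate) {m : ℕ} (hm : 1 ≤ m) (key : α → List ℕ) (sz : α → ℕ) (A : List α)
    (Z : ℕ) (hZ : ∀ x ∈ A, sz x ≤ Z) (hkey : ∀ x ∈ A, bitsList (key x) ≤ sz x) :
    (parSort K m key sz A).val.length = A.length ∧
      (∀ x ∈ (parSort K m key sz A).val, x ∈ A) ∧
      (∀ i j, i ≤ j → j < A.length → key (entry (parSort K m key sz A).val i) ≤
        key (entry (parSort K m key sz A).val j)) ∧
      m * (parSort K m key sz A).time ≤ bits A.length * ((A.length + 2 * m) *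
        K.charge (200 * (bits A.length * (bits A.length + Z)))) := by
  set N := A.length with hN
  set c := K.charge (200 * (bits N * (bits N + Z))) with hc
  obtain ⟨⟨h1, h2, h3, h4⟩, h5⟩ := foldlM_spec (fun (s : ℕ × List α) (_ : ℕ) => do
    let B ← mergeRound K m key sz s.1 s.2
    let w ← mul K 2 s.1
    pure (w, B)) (fun i s => s.1 = 2 ^ i ∧ s.2.length = N ∧ (∀ x ∈ s.2, x ∈ A) ∧
      BlockSorted key s.1 s.2) ((N + m) * c / m + c) (List.range (Nat.clog 2 N)) (1, A)
    ⟨rfl, rfl, fun _ hx => hx, fun i j _ _ hij => by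
      obtain rfl : i = j := by simpa using hij
      exact le_rfl⟩ (by
      rintro i ⟨w, B⟩ _ hi ⟨rfl, hlen, hmem, hsorted⟩
      rw [List.length_range] at hi
      have hw : 2 ^ i < N := (Nat.lt_clog_iff_pow_lt (by norm_num)).1 hi
      obtain ⟨g1, g2, g3⟩ := hsorted.mergeRound (K := K) (sz := sz) (by positivity) m
      have ht := mergeRound_time_le (K := K) hm (w := 2 ^ i) B Z (by rw [hlen]; exact hw.le)
        (fun x hx => hZ x (hmem x hx)) (fun x hx => hkey x (hmem x hx))
      simp only [hlen] at g1 ht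
      simp only [bind_val, bind_time, mul_val, mul_time, pure_val, pure_time, add_zero]
      refine ⟨⟨by rw [pow_succ, mul_comm], g1, fun x hx => hmem x (g2 x hx), g3⟩,
        Nat.add_le_add ?_ (K.charge_mono ?_)⟩
      · rw [Nat.le_div_iff_mul_le hm, mul_comm]
        exact ht
      · have := bits_mono hw.le
        have h0 := one_le_bits N
        rw [bits_two]
        nlinarith [Nat.zero_le (bits N * Z), Nat.mul_le_mul h0 h0])
  rw [List.length_range] at h1 h5
  have hval : (parSort K m key sz A).val = ((List.range (Nat.clog 2 N)).foldlM
    (fun (s : ℕ × List α) (_ : ℕ) => do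
    let B ← mergeRound K m key sz s.1 s.2
    let w ← mul K 2 s.1
    pure (w, B)) (1, A)).val.2 := rfl
  have htime : (parSort K m key sz A).time = ((List.range (Nat.clog 2 N)).foldlM
    (fun (s : ℕ × List α) (_ : ℕ) => do
    let B ← mergeRound K m key sz s.1 s.2
    let w ← mul K 2 s.1
    pure (w, B)) (1, A)).time := rfl
  rw [← hval] at h2 h3 h4
  rw [← htime] at h5
  refine ⟨h2, h3, fun i j hij hj => h4 i j hij (by rwa [h2]) ?_, ?_⟩
  · have hw : N ≤ 2 ^ Nat.clog 2 N := Nat.le_pow_clog (by norm_num) N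
    rw [h1, Nat.div_eq_of_lt (by omega), Nat.div_eq_of_lt (by omega)]
  · have hlog : Nat.clog 2 N ≤ bits N :=
      (Nat.clog_le_of_le_pow (Nat.lt_size_self N).le).trans (Nat.le_succ _)
    have hdiv := Nat.mul_div_le ((N + m) * c) m
    calc _ ≤ m * (Nat.clog 2 N * ((N + m) * c / m + c)) := Nat.mul_le_mul_left _ h5
      _ = Nat.clog 2 N * (m * ((N + m) * c / m) + m * c) := by ring
      _ ≤ bits N * ((N + m) * c + m * c) := by gcongr
      _ = _ := by ring

end MergeSort

/-! ### Images -/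

theorem alphaPowers_time_le (K : Rate) {x D q n : ℕ} (hq : 0 < q) (hx : x ≤ q) :
    (alphaPowers K x D q n).time ≤ K.charge (n * (D.size * (10 * bits q))) := by
  obtain ⟨-, h⟩ := foldlM_spec (fun (s : ℕ × List ℕ) (_ : ℕ) => do
    let y ← powMod K s.1 D q
    pure (y, s.2 ++ [y])) (fun _ s => s.1 ≤ q) (K.charge (D.size * (10 * bits q)))
    (List.range (n - 1)) (x, [x]) hx (fun _ s _ _ hs => by
      simpa using powMod_spec K s.1 D hq hs)
  rw [List.length_range] at h
  simp only [alphaPowers, bind_time, pure_time, add_zero]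
  refine h.trans ((K.mul_charge_le _ _).trans (K.charge_mono ?_))
  gcongr
  omega

theorem degreePowers_time_le (K : Rate) {D p n : ℕ} (hp : 0 < p) :
    (degreePowers K D p n).time ≤ K.charge (bits D + bits p + n * (5 * bits p)) := by
  obtain ⟨-, h⟩ := foldlM_spec (fun (s : ℕ × List ℕ) (_ : ℕ) => do
    let y ← mulMod K s.1 (D % p) p
    pure (y, s.2 ++ [y])) (fun _ s => s.1 ≤ p) (K.charge (5 * bits p))
    (List.range (n - 1)) (1, [1]) hp (fun _ s _ _ hs => by
      have h1 := mulMod_time_le K (bits_mono hs) (bits_mono (Nat.mod_lt D hp).le) le_rfl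
      simpa [mulMod_val] using ⟨(Nat.mod_lt _ hp).le, h1⟩)
  rw [List.length_range] at h
  simp only [degreePowers, bind_time, pure_time, add_zero, divMod_val, divMod_time]
  refine K.add_le_charge le_rfl (h.trans ((K.mul_charge_le _ _).trans (K.charge_mono ?_))) le_rfl
  gcongr
  omega

theorem evalImage_entry_lt (K : Rate) {n : ℕ} (f : MvPolynomial (Fin n) ℤ) {q : ℕ} (hq : 0 < q)
    (p : ℕ) (a d : List ℕ) (j : ℕ) : entry (evalImage K f q p a d).val j < q := by
  have : NeZero q := ⟨hq.ne'⟩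
  by_cases hj : j < (evalImage K f q p a d).val.length
  · obtain ⟨i, -, hi⟩ := List.mem_map.1 (entry_mem _ hj)
    exact lt_of_eq_of_lt hi.symm (ZMod.val_lt _)
  -- Outside the list the default entry is 0, which is below `q` as well.
  · rw [entry, List.getD_eq_default _ _ (by omega)]
    exact hq

/-- A term of an image over `ℤ/qℤ`, for a prime that is at most `P`. -/
def Image.Bounded (q P : ℕ) (t : Image) : Prop :=
  t.coeff < q ∧ t.expo < t.prime ∧ t.prime ≤ P

theorem Image.Bounded.size_le {q P : ℕ} {t : Image} (h : t.Bounded q P) :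
    t.size ≤ bits q + 2 * bits P := by
  have h1 := bits_mono h.1.le
  have h2 := bits_mono (h.2.1.le.trans h.2.2)
  have h3 := bits_mono h.2.2
  simp only [Image.size]
  omega

/-- List the term of exponent `j` of an image unless its coefficient is zero. -/
def listTerm (K : Rate) (fi : List ℕ) (p j : ℕ) : Timed (List Image) := do
  let c ← read K bits fi j
  let zero ← eq K c 0
  if zero then pure []
  else do
    pay K (Image.size ⟨c, j, p⟩)
    pure [(⟨c, j, p⟩ : Image)]

theorem listTerm_spec (K : Rate) (fi : List ℕ) {q p j : ℕ} (hq : ∀ j, entry fi j < q)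
    (hj : j < p) :
    (listTerm K fi p j).val.length ≤ 1 ∧ (∀ t ∈ (listTerm K fi p j).val, t.Bounded q p) ∧
      (listTerm K fi p j).time ≤ K.charge (4 * (bits p + bits q)) := by
  have h1 := bits_mono (hq j).le
  have h2 := bits_mono hj.le
  have h3 := one_le_bits p
  have h4 := one_le_bits q
  have z := bits_zero
  simp only [listTerm, bind_val, bind_time, read_val, read_time, eq_val, eq_time]
  change bits (entry fi j) ≤ _ at h1
  rw [show fi.getD j default = entry fi j from rfl]
  by_cases h : entry fi j = 0
  · simp only [h, decide_true, if_true, pure_val, pure_time, add_zero]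
    refine ⟨by simp, by simp, K.add_le_charge le_rfl le_rfl ?_⟩
    omega
  · simp only [h, decide_false, Bool.false_eq_true, if_false, bind_val, bind_time, pure_val,
      pure_time, add_zero, pay_time]
    refine ⟨by simp, ?_, K.add_le_charge le_rfl (K.add_le_charge le_rfl le_rfl le_rfl) ?_⟩
    · intro t ht
      obtain rfl := List.mem_singleton.1 ht
      exact ⟨hq j, hj, le_rfl⟩
    · simp only [Image.size]
      omega

/-- Every exponent below the prime yields at most one triple. The dense image and the scan of its
coefficients give the summand that is linear in the prime, the reduced powers of `D` the one that is
linear in `n`. -/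
theorem imageStep_spec (K : Rate) {n : ℕ} (f : MvPolynomial (Fin n) ℤ) (D : ℕ) (ω : Choices)
    (alphas : List ℕ) (i : ℕ) (hq : 0 < ω.q) (hp : 0 < ω.p i) :
    (imageStep K f D ω alphas i).val.length ≤ ω.p i ∧
      (∀ t ∈ (imageStep K f D ω alphas i).val, t.Bounded ω.q (ω.p i)) ∧
      (imageStep K f D ω alphas i).time ≤ K.charge (bits i + bits D + (5 * n + 2) * bits (ω.p i) +
        ω.p i * (4 * bits (ω.p i) + 5 * bits ω.q)) := by
  set ds := (degreePowers K D (ω.p i) n).val with hds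
  set fi := (evalImage K f ω.q (ω.p i) alphas ds).val with hfi
  have hlt : ∀ j, entry fi j < ω.q := fun j => evalImage_entry_lt K f hq _ _ _ _
  have e : imageStep K f D ω alphas i = (do
      pay K (bits i)
      pay K (bits (ω.p i))
      let ds ← degreePowers K D (ω.p i) n
      let fi ← evalImage K f ω.q (ω.p i) alphas ds
      let found ← forEach (List.range (ω.p i)) (listTerm K fi (ω.p i))
      pure found.flatten) := rfl
  have hval : (imageStep K f D ω alphas i).val =
      ((List.range (ω.p i)).map fun j => (listTerm K fi (ω.p i) j).val).flatten := rfl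
  refine ⟨?_, ?_, ?_⟩
  · rw [hval, List.length_flatten, List.map_map]
    refine (List.sum_le_card_nsmul _ 1 ?_).trans (by simp)
    intro x hx
    obtain ⟨j, hj, rfl⟩ := List.mem_map.1 hx
    exact (listTerm_spec K fi hlt (List.mem_range.1 hj)).1
  · intro t ht
    rw [hval, List.mem_flatten] at ht
    obtain ⟨l, hl, ht⟩ := ht
    obtain ⟨j, hj, rfl⟩ := List.mem_map.1 hl
    exact (listTerm_spec K fi hlt (List.mem_range.1 hj)).2.1 t ht
  · have h1 := degreePowers_time_le K (D := D) (n := n) hp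
    have h2 := forEach_time_le K (List.range (ω.p i)) (listTerm K fi (ω.p i)) _
      fun j hj => (listTerm_spec K fi hlt (List.mem_range.1 hj)).2.2
    have h3 : (evalImage K f ω.q (ω.p i) alphas ds).time = K.charge (ω.p i * bits ω.q) := rfl
    rw [List.length_range] at h2
    rw [e]
    simp only [bind_time, pay_time, pure_time, add_zero, ← hds, h3, ← hfi]
    refine K.add_le_charge le_rfl (K.add_le_charge le_rfl (K.add_le_charge h1
      (K.add_le_charge le_rfl h2 le_rfl) le_rfl) le_rfl) (le_of_eq ?_)
    ring

/-! ### Terms -/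

section Terms

variable (K : Rate) {q P : ℕ} {L : List Image}

/-- In a sorted list the entries from `s` on that share the coefficient of `s` form an initial
segment, so binary search applies. Only one half of its correctness is recorded: all counted entries
have this coefficient. -/
theorem runLength_spec (hL : ∀ t ∈ L, t.Bounded q P)
    (hsort : ∀ i j, i ≤ j → j < L.length → (entry L i).coeff ≤ (entry L j).coeff) {s : ℕ}
    (hs : s < L.length) :
    s + (runLength K L (entry L s).coeff s).val ≤ L.length ∧
      (∀ j, s ≤ j → j < s + (runLength K L (entry L s).coeff s).val →
        (entry L j).coeff = (entry L s).coeff) ∧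
      (runLength K L (entry L s).coeff s).time ≤
        K.charge (20 * (bits L.length * (bits L.length + (bits q + 2 * bits P)))) := by
  set N := L.length with hN
  set b := bits q + 2 * bits P with hb
  set c := (entry L s).coeff with hc
  let test : ℕ → Timed Bool := fun j => do
    let y ← read K Image.size L j
    eq K y.coeff c
  have hv : ∀ j, (test j).val = decide ((entry L j).coeff = c) := fun _ => rfl
  have hbc : bits c ≤ bits q := bits_mono (hL _ (entry_mem L hs)).1.le
  have ht : ∀ j, s ≤ j → j < N → (test j).time ≤ K.charge (bits N + 3 * b) := fun j _ hj => by
    have h1 := (hL _ (entry_mem L hj)).size_le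
    have h2 := bits_mono (hL _ (entry_mem L hj)).1.le
    have h3 := bits_mono hj.le
    simp only [test, bind_time, read_time, read_val, eq_time, getD_eq_entry]
    exact K.add_le_charge le_rfl le_rfl (by omega)
  obtain ⟨h1, h2⟩ := search_mem K test hs.le
  obtain ⟨h3, -⟩ := search_val K test hs.le (by
    intro i j hi hij hj
    simp only [hv, decide_eq_true_eq]
    intro h
    exact le_antisymm ((hsort i j hij hj).trans h.le) (hsort s i hi (by omega)))
  have h4 := search_time_le K test hs.le ht
  have hval : (runLength K L c s).val = (search K test s N).val - s := rfl
  have htime : (runLength K L c s).time =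
      (search K test s N).time + K.charge (bits (search K test s N).val + bits s) := rfl
  rw [hval, htime]
  refine ⟨by omega, fun j hj hj' => by simpa [hv] using h3 j hj (by omega), ?_⟩
  refine K.add_le_charge h4 le_rfl ?_
  have b1 := bits_mono h2
  have b2 := bits_mono hs.le
  have b3 := one_le_bits N
  nlinarith [Nat.zero_le (bits N * b)]

theorem readRun_spec (hL : ∀ t ∈ L, t.Bounded q P) {s w : ℕ} (hs : s + w ≤ L.length) :
    (readRun K L s w).val.length = w ∧ (∀ t ∈ (readRun K L s w).val, t.Bounded q P) ∧
      (readRun K L s w).time ≤ K.charge (w * (3 * bits L.length + (bits q + 2 * bits P))) := by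
  refine ⟨by simp [readRun, forEach], fun t ht => ?_, ?_⟩
  · obtain ⟨i, hi, rfl⟩ := List.mem_map.1 ht
    rw [List.mem_range] at hi
    exact hL _ (entry_mem L (show s + i < L.length by omega))
  · have := forEach_time_le K (List.range w) (fun i => do
      let j ← add K s i
      read K Image.size L j) (3 * bits L.length + (bits q + 2 * bits P)) (by
        intro i hi
        rw [List.mem_range] at hi
        have h1 := (hL _ (entry_mem L (show s + i < L.length by omega))).size_le
        have b1 := bits_mono (show s ≤ L.length by omega)
        have b2 := bits_mono (show i ≤ L.length by omega)
        have b3 := bits_mono (show s + i ≤ L.length by omega)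
        simp only [bind_time, add_time, add_val, read_time, getD_eq_entry]
        exact K.add_le_charge le_rfl le_rfl (by omega))
    rwa [List.length_range] at this

/-- Work of linear order on a run of at most `M` entries, with a logarithmic factor. -/
def runWork (M N q P : ℕ) : ℕ := bits M * (M * (3 * bits N + (bits q + 2 * bits P)))

theorem le_runWork {w M N q P : ℕ} (hw : w ≤ M) :
    w * (3 * bits N + (bits q + 2 * bits P)) ≤ runWork M N q P ∧
      w.size * (w * bits P) ≤ runWork M N q P := by
  have h1 := one_le_bits M
  have h2 : w.size ≤ bits M := (Nat.size_le_size hw).trans (Nat.le_succ _)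
  have h3 : bits P ≤ 3 * bits N + (bits q + 2 * bits P) := by omega
  have h4 : w * (3 * bits N + (bits q + 2 * bits P)) ≤ runWork M N q P := by
    unfold runWork
    calc _ ≤ M * (3 * bits N + (bits q + 2 * bits P)) := by gcongr
      _ ≤ _ := Nat.le_mul_of_pos_left _ h1
  refine ⟨h4, ?_⟩
  unfold runWork
  gcongr

theorem runProduct_spec (hL : ∀ t ∈ L, t.Bounded q P) {s w M : ℕ} (hs : s + w ≤ L.length)
    (hw : w ≤ M) :
    bits (runProduct K L s w).val ≤ runWork M L.length q P + 2 ∧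
      (runProduct K L s w).time ≤ K.charge (2 * runWork M L.length q P) := by
  obtain ⟨h1, h2, h3⟩ := readRun_spec K hL hs
  obtain ⟨h4, h5⟩ := prodTree_spec K ((readRun K L s w).val.map Image.prime) (bits P) (by
    intro x hx
    obtain ⟨t, ht, rfl⟩ := List.mem_map.1 hx
    exact bits_mono (h2 t ht).2.2)
  rw [List.length_map, h1] at h4 h5
  obtain ⟨g1, g2⟩ := le_runWork (N := L.length) (q := q) (P := P) hw
  have g3 : w * bits P ≤ w * (3 * bits L.length + (bits q + 2 * bits P)) := by
    gcongr
    omega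
  simp only [runProduct, bind_val, bind_time]
  exact ⟨h4.trans (by omega), K.add_le_charge h3 h5 (by omega)⟩

/-- Work for the recovery of a term from an exponent of at most `e` bits. -/
def recoverWork (n D q e : ℕ) : ℕ :=
  e * (10 * bits q) + 25 * bits q +
    bits n * (6 * (n * (n.size * (20 * bits D)) + (e + 2 * n))) + n * bits D

theorem recoverTerm_spec {n D α c E e : ℕ} (hn : 1 ≤ n) (hD : 1 ≤ D) (hα : α ≤ q) (hq : 0 < q)
    (hc : c ≤ q) (hE : bits E ≤ e) :
    termSize (recoverTerm K n D q α c E).val ≤ bits q + n * bits D + 2 ∧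
      bitsList (recoverTerm K n D q α c E).val.2 ≤ termSize (recoverTerm K n D q α c E).val ∧
      (recoverTerm K n D q α c E).time ≤ K.charge (recoverWork n D q e) := by
  set β := (invMod K α q).val with hβ
  have hβq : β ≤ q := (invMod_val_lt K α hq).le
  obtain ⟨h1, h2⟩ := powMod_spec K β E hq hβq
  set b := (powMod K β E q).val with hb
  have h3 := mulMod_time_le K (bits_mono hc) (bits_mono h1) (le_refl (bits q))
  set r := (mulMod K c b q).val with hr
  have hrq : r ≤ q := (Nat.mod_lt _ hq).le
  obtain ⟨h4, h5⟩ := digits_spec K hD hn E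
  set es := (digits K D n E).val with hes
  let cc : Timed ℤ := if (lt K q (2 * r)).val then do
      let s ← sub K q r
      pure (-(s : ℤ))
    else pure (r : ℤ)
  have hcc : cc.val.natAbs ≤ q ∧ cc.time ≤ K.charge (2 * bits q) := by
    by_cases hbig : q < 2 * r
    · have e : cc = (do
        let s ← sub K q r
        pure (-(s : ℤ))) := by simp [cc, hbig]
      have := bits_mono hrq
      rw [e]
      simp only [bind_val, bind_time, sub_val, sub_time, pure_val, pure_time, Int.natAbs_neg,
        Int.natAbs_natCast]
      exact ⟨Nat.sub_le _ _, K.charge_mono (by omega)⟩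
    · have e : cc = pure (r : ℤ) := by simp [cc, hbig]
      rw [e]
      simpa using hrq
  have hval : (recoverTerm K n D q α c E).val = (cc.val, es) := rfl
  have htime : (recoverTerm K n D q α c E).time = (invMod K α q).time + ((powMod K β E q).time +
      ((mulMod K c b q).time + ((mul K 2 r).time + ((lt K q (2 * r)).time + (cc.time +
      ((digits K D n E).time + ((pay K (termSize (cc.val, es))).time + 0))))))) := rfl
  have hsz : termSize (cc.val, es) ≤ bits q + n * bits D + 2 := by
    have := bits_mono hcc.1
    simp only [termSize]
    omega
  rw [hval, htime]
  refine ⟨hsz, by simp only [termSize]; omega, ?_⟩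
  simp only [invMod_time, mul_time, lt_time, pay_time, add_zero]
  refine K.add_le_charge le_rfl (K.add_le_charge h2 (K.add_le_charge h3 (K.add_le_charge le_rfl
    (K.add_le_charge le_rfl (K.add_le_charge hcc.2 (K.add_le_charge h5 le_rfl le_rfl) le_rfl)
    le_rfl) le_rfl) le_rfl) le_rfl) ?_
  have b1 := bits_mono hα
  have b2 := bits_mono hrq
  have b3 := bits_two_mul_le r
  have b4 := one_le_bits q
  have b5 := bits_two
  have b6 : E.size ≤ e := (Nat.le_succ _).trans hE
  have b7 : E.size * (10 * bits q) ≤ e * (10 * bits q) := by gcongr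
  have b8 : (n.size + 1) * (6 * (n * (n.size * (20 * (D.size + 1))) + (E.size + 2 * n))) ≤
      bits n * (6 * (n * (n.size * (20 * bits D)) + (e + 2 * n))) := by
    unfold bits
    gcongr
  unfold recoverWork
  omega

end Terms

/-! ### An iteration of the second loop, and the number of heavy coefficients. -/

section Terms

variable (K : Rate) {q P : ℕ} {L : List Image}

/-- The part of an iteration of the second loop that is executed for the first entry `x` of a
run of sufficient length `u`. -/
def runStep (n D Dn q α : ℕ) (L : List Image) (s u : ℕ) (x : Image) :
    Timed (List (ℤ × List ℕ)) := do
  let most ← mul K n (Nat.size D)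
  let long ← lt K most u
  let hi := if long then most else u
  let u' ← search K (fun w => do
    let P ← runProduct K L s w
    lt K P Dn) 0 hi
  let P ← runProduct K L s u'
  let small ← lt K P Dn
  if small then pure []
  else do
    let run ← readRun K L s u'
    let sol ← crt K (run.map fun t => (t.expo, t.prime))
    match sol with
    | none => pure []
    | some (E, _) => do
        let t ← recoverTerm K n D q α x.coeff E
        pure [t]

/-- Whether the entry before entry `s` exists and has the same coefficient as `x`. -/
def isRepeated (L : List Image) (s : ℕ) (x : Image) (first : Bool) : Timed Bool :=
  if first then pure false
  else do
    let s' ← sub K s 1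
    let y ← read K Image.size L s'
    eq K y.coeff x.coeff

theorem termStep_eq (n D mu Dn q α : ℕ) (L : List Image) (s : ℕ) :
    termStep K n D mu Dn q α L s = (do
      let x ← read K Image.size L s
      let first ← eq K s 0
      let repeated ← isRepeated K L s x first
      if repeated then pure []
      else do
        let u ← runLength K L x.coeff s
        let twice ← mul K 2 u
        let few ← lt K twice mu
        if few then pure []
        else runStep K n D Dn q α L s u x) := by
  unfold termStep isRepeated runStep
  refine congrArg (Bind.bind _) (funext fun x => congrArg (Bind.bind _) (funext fun first =>
    congrArg (Bind.bind _) (funext fun repeated => if_congr Iff.rfl rfl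
    (congrArg (Bind.bind _) (funext fun u => congrArg (Bind.bind _) (funext fun twice =>
    congrArg (Bind.bind _) (funext fun few => if_congr Iff.rfl rfl
    (congrArg (Bind.bind _) (funext fun most => congrArg (Bind.bind _) (funext fun long =>
    congrArg (Bind.bind _) (funext fun u' => congrArg (Bind.bind _) (funext fun P =>
    congrArg (Bind.bind _) (funext fun small => if_congr Iff.rfl rfl
    (congrArg (Bind.bind _) (funext fun run => congrArg (Bind.bind _) (funext fun sol =>
    ?_))))))))))))))))
  -- The two `match` expressions are compared constructor by constructor.
  rcases sol with _ | ⟨E, M⟩ <;> rfl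

theorem isRepeated_spec (hL : ∀ t ∈ L, t.Bounded q P) {s : ℕ} (hs : s < L.length) :
    ((isRepeated K L s (entry L s) (decide (s = 0))).val = false →
      s ≠ 0 → (entry L (s - 1)).coeff ≠ (entry L s).coeff) ∧
      (isRepeated K L s (entry L s) (decide (s = 0))).time ≤
        K.charge (4 * bits L.length + 3 * (bits q + 2 * bits P)) := by
  by_cases h : s = 0
  · simp [isRepeated, h]
  · have h1 := (hL _ (entry_mem L (show s - 1 < L.length by omega))).size_le
    have h2 := bits_mono (hL _ (entry_mem L (show s - 1 < L.length by omega))).1.le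
    have h3 := bits_mono (hL _ (entry_mem L hs)).1.le
    have b1 := bits_mono hs.le
    have b2 := bits_mono (show s - 1 ≤ L.length by omega)
    have b3 := bits_one
    have b4 := one_le_bits L.length
    simp only [isRepeated, h, decide_false, Bool.false_eq_true, if_false, bind_val, bind_time,
      sub_val, sub_time, read_val, read_time, eq_val, eq_time, getD_eq_entry,
      decide_eq_false_iff_not]
    exact ⟨fun h _ => h, K.add_le_charge le_rfl (K.add_le_charge le_rfl le_rfl le_rfl) (by omega)⟩

/-- Work for the recovery of a term from the entries with its coefficient. -/
def runStepWork (n D N q P dn : ℕ) : ℕ :=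
  bits (n * D.size) * (80 * runWork (n * D.size) N q P + 2 * dn) + 2 * bits N +
    recoverWork n D q (n * D.size * bits P + 2)

/-- The cap M = n|D| on the searched lengths bounds every product and the final Chinese remaindering
by M primes, however long the run is. Recomputing the product in each step of the binary search
costs only a further factor `bits M`. -/
theorem runStep_spec {n D Dn α dn s u : ℕ} {x : Image} (hL : ∀ t ∈ L, t.Bounded q P)
    (hn : 1 ≤ n) (hD : 1 ≤ D) (hα : α ≤ q) (hq : 0 < q) (hx : x.coeff ≤ q) (hDn : bits Dn ≤ dn)
    (hs : s + u ≤ L.length) :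
    (runStep K n D Dn q α L s u x).val.length ≤ 1 ∧
      (∀ t ∈ (runStep K n D Dn q α L s u x).val, termSize t ≤ bits q + n * bits D + 2 ∧
        bitsList t.2 ≤ termSize t) ∧
      (runStep K n D Dn q α L s u x).time ≤ K.charge (runStepWork n D L.length q P dn) := by
  set M := n * D.size with hM
  set W := runWork M L.length q P with hW
  have hM1 : 1 ≤ M := Nat.mul_pos hn (Nat.size_pos.2 hD)
  set hi := if decide (M < u) then M else u with hhi
  have hiM : hi ≤ M := by
    rw [hhi]
    split <;> simp_all
  have hiu : hi ≤ u := by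
    rw [hhi]
    split <;> simp_all
    omega
  have hMW : bits M ≤ W := Nat.le_mul_of_pos_right _ (Nat.mul_pos hM1 (by
    have := one_le_bits L.length
    omega))
  have pM : 2 ≤ bits M := bits_one ▸ bits_mono hM1
  let test : ℕ → Timed Bool := fun w => do
    let P ← runProduct K L s w
    lt K P Dn
  have ht : ∀ w, 0 ≤ w → w < hi → (test w).time ≤ K.charge (3 * W + dn + 2) := fun w _ hw => by
    obtain ⟨g1, g2⟩ := runProduct_spec K (M := M) hL (show s + w ≤ L.length by omega) (by omega)
    simp only [test, bind_time, lt_time]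
    exact K.add_le_charge g2 le_rfl (by omega)
  obtain ⟨-, h1⟩ := search_mem K test (Nat.zero_le hi)
  have h2 := search_time_le K test (Nat.zero_le hi) ht
  set u' := (search K test 0 hi).val with hu'
  obtain ⟨g1, g2⟩ := runProduct_spec K (M := M) hL (show s + u' ≤ L.length by omega) (by omega)
  obtain ⟨r1, r2, r3⟩ := readRun_spec K hL (show s + u' ≤ L.length by omega)
  obtain ⟨k1, k2⟩ := le_runWork (N := L.length) (q := q) (P := P) (show u' ≤ M by omega)
  set pr := (runProduct K L s u').val with hpr
  set run := (readRun K L s u').val.map fun t => (t.expo, t.prime) with hrun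
  obtain ⟨c1, c2⟩ := crt_spec K run (bits P) (by
    intro y hy
    obtain ⟨t, ht, rfl⟩ := List.mem_map.1 hy
    exact ⟨(r2 t ht).2.1, bits_mono (r2 t ht).2.2⟩)
  rw [hrun, List.length_map, r1, ← hrun] at c1 c2
  let tail : Timed (List (ℤ × List ℕ)) := if (lt K pr Dn).val then pure []
    else do
      let run ← readRun K L s u'
      let sol ← crt K (run.map fun t => (t.expo, t.prime))
      match sol with
      | none => pure []
      | some (E, _) => do
          let t ← recoverTerm K n D q α x.coeff E
          pure [t]
  have htail : tail.val.length ≤ 1 ∧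
      (∀ t ∈ tail.val, termSize t ≤ bits q + n * bits D + 2 ∧ bitsList t.2 ≤ termSize t) ∧
      tail.time ≤ K.charge (41 * W + recoverWork n D q (M * bits P + 2)) := by
    by_cases hsmall : pr < Dn
    · have e : tail = pure [] := by simp [tail, hsmall]
      simp [e]
    · have e : tail = (do
        let run ← readRun K L s u'
        let sol ← crt K (run.map fun t => (t.expo, t.prime))
        match sol with
        | none => pure []
        | some (E, _) => do
            let t ← recoverTerm K n D q α x.coeff E
            pure [t]) := by simp [tail, hsmall]
      rw [e]
      simp only [bind_val, bind_time, ← hrun]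
      rcases hsol : (crt K run).val with _ | ⟨E, _⟩
      · simp only [pure_val, pure_time, add_zero]
        refine ⟨by simp, by simp, K.add_le_charge r3 c2 ?_⟩
        rw [mul_left_comm]
        omega
      · obtain ⟨d1, d2, d3⟩ := recoverTerm_spec K (e := M * bits P + 2) hn hD hα hq hx
          ((c1 _ _ hsol).trans (by gcongr; omega))
        simp only [bind_val, bind_time, pure_val, pure_time, add_zero]
        refine ⟨by simp, fun t ht => ?_, K.add_le_charge r3 (K.add_le_charge c2 d3 le_rfl) ?_⟩
        · obtain rfl := List.mem_singleton.1 ht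
          exact ⟨d1, d2⟩
        · rw [mul_left_comm]
          omega
  have hval : (runStep K n D Dn q α L s u x).val = tail.val := rfl
  have htime : (runStep K n D Dn q α L s u x).time = (mul K n D.size).time + ((lt K M u).time +
    ((search K test 0 hi).time + ((runProduct K L s u').time + ((lt K pr Dn).time +
    tail.time)))) := rfl
  rw [hval, htime]
  refine ⟨htail.1, htail.2.1, ?_⟩
  simp only [mul_time, lt_time]
  refine K.add_le_charge le_rfl (K.add_le_charge le_rfl (K.add_le_charge h2 (K.add_le_charge g2
    (K.add_le_charge le_rfl htail.2.2 le_rfl) le_rfl) le_rfl) le_rfl) ?_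
  have b1 : bits n ≤ bits M := bits_mono (Nat.le_mul_of_pos_right _ (Nat.size_pos.2 hD))
  have b2 : bits D.size ≤ bits M := bits_mono (Nat.le_mul_of_pos_left _ hn)
  have b3 : bits u ≤ bits L.length := bits_mono (by omega)
  have b4 : bits hi ≤ bits M := bits_mono hiM
  have b5 : bits hi * (12 * bits hi + (3 * W + dn + 2)) ≤ bits M * (17 * W + dn) :=
    Nat.mul_le_mul b4 (by omega)
  have b6 : bits M * (80 * W + 2 * dn) =
      bits M * (17 * W + dn) + bits M * (63 * W + dn) := by ring
  have b7 : 63 * W + dn ≤ bits M * (63 * W + dn) := Nat.le_mul_of_pos_left _ (by omega)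
  unfold runStepWork
  rw [← hM, ← hW]
  omega

/-- Entry `s` is the first one with its coefficient, and at least `mu / 2` entries have it. -/
def IsHeavy (L : List Image) (mu s : ℕ) : Prop :=
  (s ≠ 0 → (entry L (s - 1)).coeff ≠ (entry L s).coeff) ∧
    mu ≤ 2 * (runLength K L (entry L s).coeff s).val

open Classical in
-- The cheap part, paid by every entry of the list, is kept apart from the expensive part, paid by
-- heavy entries only: there are many entries but few heavy ones.
theorem termStep_spec {n D Dn α dn mu s : ℕ} (hL : ∀ t ∈ L, t.Bounded q P)
    (hsort : ∀ i j, i ≤ j → j < L.length → (entry L i).coeff ≤ (entry L j).coeff)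
    (hn : 1 ≤ n) (hD : 1 ≤ D) (hα : α ≤ q) (hq : 0 < q) (hDn : bits Dn ≤ dn)
    (hs : s < L.length) :
    (termStep K n D mu Dn q α L s).val.length ≤ (if IsHeavy K L mu s then 1 else 0) ∧
      (∀ t ∈ (termStep K n D mu Dn q α L s).val, termSize t ≤ bits q + n * bits D + 2 ∧
        bitsList t.2 ≤ termSize t) ∧
      (termStep K n D mu Dn q α L s).time ≤
        K.charge (40 * (bits L.length * (bits L.length + (bits q + 2 * bits P))) + bits mu) +
        if IsHeavy K L mu s then K.charge (runStepWork n D L.length q P dn) else 0 := by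
  set N := L.length with hN
  set b := bits q + 2 * bits P with hb
  have hx := hL _ (entry_mem L hs)
  have h1 := hx.size_le
  have b1 := bits_mono hs.le
  have pN := one_le_bits N
  have z := bits_zero
  have z2 := bits_two
  obtain ⟨i1, i2⟩ := isRepeated_spec K hL hs
  obtain ⟨r1, r2, r3⟩ := runLength_spec K hL hsort hs
  rw [← hN, ← hb] at i2 r3
  have hNb : bits N + b ≤ bits N * (bits N + b) := Nat.le_mul_of_pos_left _ pN
  rw [termStep_eq]
  simp only [bind_val, bind_time, read_val, read_time, eq_val, eq_time, getD_eq_entry]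
  cases hrep : (isRepeated K L s (entry L s) (decide (s = 0))).val
  swap
  · simp only [if_true, pure_val, pure_time, add_zero]
    refine ⟨by simp, by simp, le_trans ?_ (Nat.le_add_right _ _)⟩
    refine K.add_le_charge le_rfl (K.add_le_charge le_rfl i2 le_rfl) ?_
    omega
  simp only [Bool.false_eq_true, if_false, bind_val, bind_time, mul_val, mul_time, lt_val, lt_time]
  set u := (runLength K L (entry L s).coeff s).val with hu
  have b2 : bits u ≤ bits N := bits_mono (by omega)
  have b3 := bits_two_mul_le u
  have base : ∀ {t T}, t ≤ T → K.charge (bits s + (entry L s).size) + (K.charge (bits s + bits 0) +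
      ((isRepeated K L s (entry L s) (decide (s = 0))).time +
      ((runLength K L (entry L s).coeff s).time + (K.charge (bits 2 + bits u) +
      (K.charge (bits (2 * u) + bits mu) + t))))) ≤
      K.charge (40 * (bits N * (bits N + b)) + bits mu) + T := by
    intro t T ht
    have := K.add_le_charge (w := 40 * (bits N * (bits N + b)) + bits mu)
      (le_refl (K.charge (bits s + (entry L s).size))) (K.add_le_charge
      (le_refl (K.charge (bits s + bits 0))) (K.add_le_charge i2 (K.add_le_charge r3
      (K.add_le_charge (le_refl (K.charge (bits 2 + bits u)))
      (le_refl (K.charge (bits (2 * u) + bits mu))) le_rfl) le_rfl) le_rfl) le_rfl) (by omega)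
    omega
  by_cases hfew : 2 * u < mu
  · simp only [hfew, decide_true, if_true, pure_val, pure_time]
    exact ⟨by simp, by simp, base (Nat.zero_le _)⟩
  · have hheavy : IsHeavy K L mu s := ⟨i1 hrep, by omega⟩
    obtain ⟨g1, g2, g3⟩ := runStep_spec K hL hn hD hα hq hx.1.le hDn r1
    simp only [hfew, decide_false, Bool.false_eq_true, if_false, hheavy, if_true]
    exact ⟨g1, g2, base g3⟩

open Classical in
-- The runs that start at heavy entries are disjoint intervals inside the list, and each has at
-- least mu/2 elements.
theorem card_isHeavy_le (hL : ∀ t ∈ L, t.Bounded q P)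
    (hsort : ∀ i j, i ≤ j → j < L.length → (entry L i).coeff ≤ (entry L j).coeff) (mu : ℕ) :
    ((Finset.range L.length).filter (IsHeavy K L mu)).card * mu ≤ 2 * L.length := by
  set S := (Finset.range L.length).filter (IsHeavy K L mu) with hS
  have hmem : ∀ s ∈ S, s < L.length ∧ IsHeavy K L mu s := fun s hs => by simpa [hS] using hs
  set u : ℕ → ℕ := fun s => (runLength K L (entry L s).coeff s).val with hu
  have hdisj : ∀ s ∈ S, ∀ t ∈ S, s < t → s + u s ≤ t := by
    intro s hs t ht hst
    obtain ⟨h1, -⟩ := hmem s hs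
    obtain ⟨h2, h3, -⟩ := hmem t ht
    obtain ⟨-, r2, -⟩ := runLength_spec K hL hsort h1
    have r2' : ∀ j, s ≤ j → j < s + u s → (entry L j).coeff = (entry L s).coeff := r2
    by_contra hcon
    -- If `t` were inside the run of `s`, so would be `t - 1`; then `t` would not be the first entry
    -- with its coefficient.
    exact h3 (by omega) ((r2' (t - 1) (by omega) (by omega)).trans (r2' t hst.le (by omega)).symm)
  have hsum : ∑ s ∈ S, u s ≤ L.length := by
    have h1 : (S.biUnion fun s => Finset.Ico s (s + u s)).card = ∑ s ∈ S, u s := by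
      rw [Finset.card_biUnion]
      · simp
      · intro s hs t ht hst
        change Disjoint (Finset.Ico _ _) (Finset.Ico _ _)
        rw [Finset.disjoint_left]
        intro a ha ha'
        rw [Finset.mem_Ico] at ha ha'
        rcases Nat.lt_or_gt_of_ne hst with h | h
        · have := hdisj s hs t ht h
          omega
        · have := hdisj t ht s hs h
          omega
    rw [← h1]
    refine (Finset.card_le_card (t := Finset.range L.length) ?_).trans (by simp)
    intro a ha
    obtain ⟨s, hs, ha⟩ := Finset.mem_biUnion.1 ha
    rw [Finset.mem_Ico] at ha
    have := (runLength_spec K hL hsort (hmem s hs).1).1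
    exact Finset.mem_range.2 (lt_of_lt_of_le ha.2 this)
  have hle : S.card * mu ≤ ∑ s ∈ S, 2 * u s := by
    rw [← smul_eq_mul]
    exact Finset.card_nsmul_le_sum S _ _ fun s hs => (hmem s hs).2.2
  rw [← Finset.mul_sum] at hle
  omega

end Terms

/-! ### Bounds for the work in terms of the parameters -/

section Work

variable {n lam D Q q Λ N P : ℕ}

/-- Writing each positive parameter as y + 1 turns the inequalities below into ones between
polynomials with natural coefficients, where `ring_nf` and `omega` compare monomial by monomial. -/
theorem pos_exists_succ {x : ℕ} (h : 1 ≤ x) : ∃ y, x = y + 1 := ⟨x - 1, by omega⟩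

theorem imageWork_le {U i p : ℕ} (hn : 1 ≤ n) (hΛ : 1 ≤ Λ) (hD : bits D ≤ 2 * D.size)
    (hq : bits q ≤ 2 * Q.size) (hQ1 : 1 ≤ Q.size) (hD1 : 1 ≤ D.size) (hlam : 1 ≤ lam)
    (hU : U = n + D.size + lam * Q.size)
    (hi : bits i ≤ 2 * Λ) (hp : p ≤ 2 * lam) (hbp : bits p ≤ 2 * Λ) :
    bits i + bits D + (5 * n + 2) * bits p + p * (4 * bits p + 5 * bits q) ≤
      6000 * Λ ^ 3 * U := by
  subst hU
  calc _ ≤ 2 * Λ + 2 * D.size + (5 * n + 2) * (2 * Λ) +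
        2 * lam * (4 * (2 * Λ) + 5 * (2 * Q.size)) := by gcongr
    _ ≤ _ := by
      generalize Q.size = bQ at *
      generalize D.size = bD at *
      clear hi hp hbp hq hD
      obtain ⟨Λ, rfl⟩ := pos_exists_succ hΛ
      obtain ⟨n, rfl⟩ := pos_exists_succ hn
      obtain ⟨bD, rfl⟩ := pos_exists_succ hD1
      obtain ⟨bQ, rfl⟩ := pos_exists_succ hQ1
      obtain ⟨lam, rfl⟩ := pos_exists_succ hlam
      ring_nf
      omega

theorem imageSortWork_le (hΛ : 1 ≤ Λ) (hq : bits q ≤ 2 * Q.size) (hQ1 : 1 ≤ Q.size)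
    (hN : bits N ≤ 2 * Λ) (hP : bits P ≤ 2 * Λ) :
    200 * (bits N * (bits N + (bits q + 2 * bits P))) ≤ 6000 * Λ ^ 3 * Q.size := by
  calc _ ≤ 200 * (2 * Λ * (2 * Λ + (2 * Q.size + 2 * (2 * Λ)))) := by gcongr
    _ ≤ _ := by
      generalize Q.size = bQ at *
      clear hq hN hP
      obtain ⟨Λ, rfl⟩ := pos_exists_succ hΛ
      obtain ⟨bQ, rfl⟩ := pos_exists_succ hQ1
      ring_nf
      omega

theorem lightWork_le {mu : ℕ} (hΛ : 1 ≤ Λ) (hq : bits q ≤ 2 * Q.size) (hQ1 : 1 ≤ Q.size)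
    (hN : bits N ≤ 2 * Λ) (hP : bits P ≤ 2 * Λ) (hmu : bits mu ≤ 2 * Λ) :
    40 * (bits N * (bits N + (bits q + 2 * bits P))) + bits mu ≤ 6000 * Λ ^ 3 * Q.size := by
  calc _ ≤ 40 * (2 * Λ * (2 * Λ + (2 * Q.size + 2 * (2 * Λ)))) + 2 * Λ := by gcongr
    _ ≤ _ := by
      generalize Q.size = bQ at *
      clear hq hN hP hmu
      obtain ⟨Λ, rfl⟩ := pos_exists_succ hΛ
      obtain ⟨bQ, rfl⟩ := pos_exists_succ hQ1
      ring_nf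
      omega

/-- This estimate dictates the common factor 6000 Λ³: the search over products alone contributes 80
· 2 · 2 · (6 + 2 + 4) = 3840. -/
theorem runStepWork_le (hn : 1 ≤ n) (hΛ : 1 ≤ Λ) (hD : bits D ≤ 2 * D.size)
    (hq : bits q ≤ 2 * Q.size) (hQ1 : 1 ≤ Q.size) (hD1 : 1 ≤ D.size)
    (hN : bits N ≤ 2 * Λ) (hP : bits P ≤ 2 * Λ) (hnb : bits n ≤ 2 * Λ)
    (hM : bits (n * D.size) ≤ 2 * Λ) :
    runStepWork n D N q P (2 * n * D.size + 2) ≤ 6000 * Λ ^ 3 * (n * D.size * Q.size) := by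
  have hns : n.size ≤ 2 * Λ := (Nat.le_succ _).trans hnb
  unfold runStepWork recoverWork runWork
  calc _ ≤ 2 * Λ * (80 * (2 * Λ * (n * D.size * (3 * (2 * Λ) + (2 * Q.size + 2 * (2 * Λ))))) +
        2 * (2 * n * D.size + 2)) + 2 * (2 * Λ) + ((n * D.size * (2 * Λ) + 2) *
        (10 * (2 * Q.size)) + 25 * (2 * Q.size) + 2 * Λ * (6 * (n * (2 * Λ * (20 * (2 * D.size))) +
        ((n * D.size * (2 * Λ) + 2) + 2 * n))) + n * (2 * D.size)) := by gcongr
    _ ≤ _ := by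
      generalize Q.size = bQ at *
      generalize D.size = bD at *
      clear hq hN hP hD hnb hns hM
      obtain ⟨Λ, rfl⟩ := pos_exists_succ hΛ
      obtain ⟨n, rfl⟩ := pos_exists_succ hn
      obtain ⟨bD, rfl⟩ := pos_exists_succ hD1
      obtain ⟨bQ, rfl⟩ := pos_exists_succ hQ1
      ring_nf
      omega

theorem termSortWork_le (hn : 1 ≤ n) (hΛ : 1 ≤ Λ) (hD : bits D ≤ 2 * D.size)
    (hq : bits q ≤ 2 * Q.size) (hQ1 : 1 ≤ Q.size) (hD1 : 1 ≤ D.size) (hN : bits N ≤ 2 * Λ) :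
    200 * (bits N * (bits N + (bits q + n * bits D + 2))) ≤
      6000 * Λ ^ 3 * (n * D.size * Q.size) := by
  calc _ ≤ 200 * (2 * Λ * (2 * Λ + (2 * Q.size + n * (2 * D.size) + 2))) := by gcongr
    _ ≤ _ := by
      generalize Q.size = bQ at *
      generalize D.size = bD at *
      clear hq hN hD
      obtain ⟨Λ, rfl⟩ := pos_exists_succ hΛ
      obtain ⟨n, rfl⟩ := pos_exists_succ hn
      obtain ⟨bD, rfl⟩ := pos_exists_succ hD1
      obtain ⟨bQ, rfl⟩ := pos_exists_succ hQ1
      ring_nf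
      omega

theorem initialWork_le {α k T l : ℕ} (hn : 1 ≤ n) (hΛ : 1 ≤ Λ) (hD : bits D ≤ 2 * D.size)
    (hq : bits q ≤ 2 * Q.size) (hα : bits α ≤ 2 * Q.size) (hQ1 : 1 ≤ Q.size) (hD1 : 1 ≤ D.size)
    (hk : bits k ≤ 2 * Λ) (hT : bits T ≤ 2 * Λ) (hl : bits l ≤ 2 * Λ)
    (hnb : bits n ≤ 2 * Λ) (hlam : bits lam ≤ 2 * Λ) :
    bits q + bits α + n * (D.size * (10 * bits q)) + (bits k + bits T) +
      (bits l + bits n + bits D + bits lam) ≤ 6000 * Λ ^ 3 * (n * D.size * Q.size) := by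
  calc _ ≤ 2 * Q.size + 2 * Q.size + n * (D.size * (10 * (2 * Q.size))) + (2 * Λ + 2 * Λ) +
        (2 * Λ + 2 * Λ + 2 * D.size + 2 * Λ) := by gcongr
    _ ≤ _ := by
      generalize Q.size = bQ at *
      generalize D.size = bD at *
      clear hq hD hα hk hT hl hnb hlam
      obtain ⟨Λ, rfl⟩ := pos_exists_succ hΛ
      obtain ⟨n, rfl⟩ := pos_exists_succ hn
      obtain ⟨bD, rfl⟩ := pos_exists_succ hD1
      obtain ⟨bQ, rfl⟩ := pos_exists_succ hQ1
      ring_nf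
      omega

theorem powerWork_le (hn : 1 ≤ n) (hΛ : 1 ≤ Λ) (hQ1 : 1 ≤ Q.size) (hD1 : 1 ≤ D.size)
    (hnb : bits n ≤ 2 * Λ) :
    n.size * (20 * (n * D.size + 1)) ≤ 6000 * Λ ^ 3 * (n * D.size * Q.size) := by
  have hns : n.size ≤ 2 * Λ := (Nat.le_succ _).trans hnb
  calc _ ≤ 2 * Λ * (20 * (n * D.size + 1)) := by gcongr
    _ ≤ _ := by
      generalize Q.size = bQ at *
      generalize D.size = bD at *
      clear hnb hns
      obtain ⟨Λ, rfl⟩ := pos_exists_succ hΛ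
      obtain ⟨n, rfl⟩ := pos_exists_succ hn
      obtain ⟨bD, rfl⟩ := pos_exists_succ hD1
      obtain ⟨bQ, rfl⟩ := pos_exists_succ hQ1
      ring_nf
      omega

end Work

/-- The factor by which a charge exceeds the work, for parameters of size `s`. -/
def Rate.overhead (K : Rate) (s : ℕ) : ℕ :=
  K.factor * (6000 * s ^ 3) * (6010 * s) ^ K.power

/-- The work is polynomial in `Z`, namely at most 6000 Z⁶, so its length is O(|Z|) and the
logarithmic factor of the charge can be pulled out. -/
theorem Rate.charge_le_overhead (K : Rate) {Z V w : ℕ} (hZ : 1 ≤ Z) (hV : V ≤ Z ^ 3)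
    (hw : w ≤ 6000 * Z.size ^ 3 * V) : K.charge w ≤ K.overhead Z.size * V := by
  have h1 : 1 ≤ Z.size := Nat.size_pos.2 hZ
  have hsize : w.size ≤ 6010 * Z.size := by
    have h2 : w ≤ 6000 * Z ^ 6 :=
      calc w ≤ 6000 * Z.size ^ 3 * V := hw
        _ ≤ 6000 * Z ^ 3 * Z ^ 3 := by
          gcongr
          exact size_le_self Z
        _ = _ := by ring
    have h3 := Nat.size_le_size h2
    have h4 := size_mul_le 6000 (Z ^ 6)
    have h5 := size_pow_le Z 6
    have h6 := size_le_self 6000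
    -- The length of 6000 is crudely bounded by 6000 itself; 6000 + 6|Z| + 1 ≤ 6010|Z|.
    omega
  unfold Rate.charge Rate.overhead
  calc K.factor * w * w.size ^ K.power
      ≤ K.factor * (6000 * Z.size ^ 3 * V) * (6010 * Z.size) ^ K.power := by gcongr
    _ = _ := by ring

/-! ### The total time of the procedure. -/

theorem sum_map_range (f : ℕ → ℕ) (r : ℕ) :
    ((List.range r).map f).sum = ∑ i ∈ Finset.range r, f i := rfl

/-- Since lg λ ≥ 1, dropping the denominator only increases the number; the integer |D| bounds lg D
and so absorbs the rounding. -/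
theorem numImages_bounds {ℓ n D lam : ℕ} (hℓ : 1 ≤ ℓ) (hn : 1 ≤ n) (hD : 2 ≤ D) (hlam : 2 ≤ lam) :
    1 ≤ numImages ℓ n D lam ∧ numImages ℓ n D lam ≤ ℓ * n * D.size := by
  have hD' : (2 : ℝ) ≤ D := by exact_mod_cast hD
  have hlam' : (2 : ℝ) ≤ lam := by exact_mod_cast hlam
  have hlogD : 0 < Real.logb 2 D := Real.logb_pos (by norm_num) (by linarith)
  have hloglam : 1 ≤ Real.logb 2 lam := by
    rw [Real.le_logb_iff_rpow_le (by norm_num) (by linarith)]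
    simpa using hlam'
  have hle : Real.logb 2 D ≤ D.size := by
    rw [Real.logb_le_iff_le_rpow (by norm_num) (by linarith), Real.rpow_natCast]
    exact_mod_cast (Nat.lt_size_self D).le
  have hℓn : (0 : ℝ) < (ℓ : ℝ) * n := by
    have : 0 < ℓ * n := Nat.mul_pos hℓ hn
    exact_mod_cast this
  constructor
  · exact Nat.ceil_pos.2 (by positivity)
  · refine Nat.ceil_le.2 ((div_le_self (by positivity) hloglam).trans ?_)
    push_cast
    gcongr

open Classical in
theorem sum_termStep_time_le (K : Rate) {q P : ℕ} {L : List Image} {n D Dn α dn mu : ℕ}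
    (hL : ∀ t ∈ L, t.Bounded q P)
    (hsort : ∀ i j, i ≤ j → j < L.length → (entry L i).coeff ≤ (entry L j).coeff)
    (hn : 1 ≤ n) (hD : 1 ≤ D) (hα : α ≤ q) (hq : 0 < q) (hDn : bits Dn ≤ dn) :
    ((List.range L.length).map fun s => (termStep K n D mu Dn q α L s).time).sum ≤
      L.length * K.charge
        (40 * (bits L.length * (bits L.length + (bits q + 2 * bits P))) + bits mu) +
      ((Finset.range L.length).filter (IsHeavy K L mu)).card *
        K.charge (runStepWork n D L.length q P dn) := by
  rw [sum_map_range]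
  refine (Finset.sum_le_sum fun s hs =>
    (termStep_spec K hL hsort hn hD hα hq hDn (Finset.mem_range.1 hs)).2.2).trans ?_
  rw [Finset.sum_add_distrib, ← Finset.sum_filter]
  simp

open Classical in
theorem length_terms_le (K : Rate) {q P : ℕ} {L : List Image} {n D Dn α dn mu : ℕ}
    (hL : ∀ t ∈ L, t.Bounded q P)
    (hsort : ∀ i j, i ≤ j → j < L.length → (entry L i).coeff ≤ (entry L j).coeff)
    (hn : 1 ≤ n) (hD : 1 ≤ D) (hα : α ≤ q) (hq : 0 < q) (hDn : bits Dn ≤ dn) :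
    ((List.range L.length).map fun s => (termStep K n D mu Dn q α L s).val).flatten.length ≤
      ((Finset.range L.length).filter (IsHeavy K L mu)).card := by
  rw [List.length_flatten, List.map_map, sum_map_range]
  refine (Finset.sum_le_sum fun s hs =>
    (termStep_spec K hL hsort hn hD hα hq hDn (Finset.mem_range.1 hs)).1).trans ?_
  rw [← Finset.sum_filter]
  simp

theorem le_of_singleton_le {a b : ℕ} (h : [a] ≤ [b]) : a ≤ b := by
  by_contra hcon
  exact absurd h (not_le.2 (List.Lex.rel (not_le.1 hcon)))

theorem bits_le_two_mul_size {x : ℕ} (hx : 1 ≤ x) : bits x ≤ 2 * x.size := by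
  have := Nat.size_pos.2 hx
  unfold bits
  omega

theorem bits_le_of_le_two_mul {x y : ℕ} (hy : 2 ≤ y) (hx : x ≤ 2 * y) : bits x ≤ 2 * y.size := by
  have h1 := (bits_mono hx).trans (bits_two_mul_le y)
  have h2 : 1 < y.size := Nat.lt_size.2 (by simpa using hy)
  unfold bits at *
  omega

/-- The work outside the parallel loops, as a function of the parameters. -/
def serialWork (n lam D Q : ℕ) : ℕ := n * D.size * Q.size + lam * Q.size

/-- The work in the parallel loops, as a function of the parameters. -/
def parallelWork (n lam D ℓ Q : ℕ) : ℕ := ℓ * n * D.size * (n + D.size + lam * Q.size)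

open Classical in
-- `Z` bounds all counts and addresses, so each of these has at most 2Λ bits, while `q` and `α` are
-- measured by |Q|. Every charge becomes G times a plain work term; sums over loops go to
-- `parallelWork`, longest iterations to `serialWork`. The remaining factor Λ pays for the rounds of
-- the two sorts.
theorem mul_sparseInterp_time_le (K : Rate) {n T D k ℓ Q m Z : ℕ} (hn : 1 ≤ n) (hD : 2 ≤ D)
    (hkT : 2 ≤ k * T) (hℓ : 1 ≤ ℓ) (hQ : 2 ≤ Q) (hm : 1 ≤ m) (f : MvPolynomial (Fin n) ℤ)
    (ω : Choices) (hω : ω.Valid Q (k * T)) (hZ : Z = n * (k * T) * D.size * Q.size * ℓ) :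
    m * (sparseInterp K m f T D k ℓ ω).time ≤ 40 * Z.size * K.overhead Z.size *
      (m * serialWork n (k * T) D Q + parallelWork n (k * T) D ℓ Q) := by
  set lam := k * T with hlam
  set bD := D.size with hbD
  set bQ := Q.size with hbQ
  set Λ := Z.size with hΛ
  have hbD2 : 2 ≤ bD := Nat.lt_size.2 (by simpa using hD)
  have hbQ2 : 2 ≤ bQ := Nat.lt_size.2 (by simpa using hQ)
  have hq0 : 0 < ω.q := hω.q_prime.pos
  have hα : ω.α ≤ ω.q := hω.α_lt.le
  have hZ1 : 1 ≤ Z := by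
    have : 0 < n * lam * bD * bQ * ℓ := by positivity
    rwa [hZ]
  have hΛ1 : 1 ≤ Λ := Nat.size_pos.2 hZ1
  have hbits : ∀ {x}, x ≤ Z → bits x ≤ 2 * Λ := fun h =>
    (bits_mono h).trans (bits_le_two_mul_size hZ1)
  have hV0Z : n * bD * bQ * (lam * ℓ) = Z := by rw [hZ]; ring
  have hlamℓ : 1 ≤ lam * ℓ := Nat.mul_pos (by omega) hℓ
  have hV0 : n * bD * bQ ≤ Z := hV0Z ▸ Nat.le_mul_of_pos_right _ hlamℓ
  have hMZ : n * bD ≤ Z := (Nat.le_mul_of_pos_right _ (by omega)).trans hV0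
  have hnZ : n ≤ Z := (Nat.le_mul_of_pos_right _ (by omega)).trans hMZ
  have hbDZ : bD ≤ Z := (Nat.le_mul_of_pos_left _ hn).trans hMZ
  have hbQZ : bQ ≤ Z := (Nat.le_mul_of_pos_left _ (Nat.mul_pos hn (by omega))).trans hV0
  have hPZ : 2 * lam ≤ Z := by
    calc 2 * lam ≤ bD * lam := by gcongr
      _ ≤ bD * lam * (n * bQ * ℓ) := Nat.le_mul_of_pos_right _ (by positivity)
      _ = Z := by rw [hZ]; ring
  have hlQZ : lam * bQ ≤ Z := by
    calc lam * bQ ≤ lam * bQ * (n * bD * ℓ) := Nat.le_mul_of_pos_right _ (by positivity)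
      _ = Z := by rw [hZ]; ring
  have hℓZ : ℓ ≤ Z := by
    calc ℓ ≤ ℓ * (n * bD * bQ * lam) := Nat.le_mul_of_pos_right _ (by positivity)
      _ = Z := by rw [hZ]; ring
  have hk1 : 1 ≤ k := by
    rcases Nat.eq_zero_or_pos k with h | h
    · simp [hlam, h] at hkT
    · exact h
  have hT1 : 1 ≤ T := by
    rcases Nat.eq_zero_or_pos T with h | h
    · simp [hlam, h] at hkT
    · exact h
  have hkZ : k ≤ Z := (Nat.le_mul_of_pos_right _ hT1).trans (by omega)
  have hTZ : T ≤ Z := (Nat.le_mul_of_pos_left _ hk1).trans (by omega)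
  have hbq : bits ω.q ≤ 2 * bQ := bits_le_of_le_two_mul hQ hω.q_upper
  have hbα : bits ω.α ≤ 2 * bQ := (bits_mono hα).trans hbq
  have hbDb : bits D ≤ 2 * bD := bits_le_two_mul_size (by omega)
  have hbP : bits (2 * lam) ≤ 2 * Λ := hbits hPZ
  obtain ⟨hmu1, hmu2⟩ := numImages_bounds hℓ hn hD hkT
  set mu := numImages ℓ n D lam with hmu
  have hN : mu * (2 * lam) ≤ Z := by
    calc mu * (2 * lam) ≤ ℓ * n * bD * (bQ * lam) := by gcongr
      _ = Z := by rw [hZ]; ring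
  have hmuZ : mu ≤ Z := (Nat.le_mul_of_pos_right _ (by omega)).trans hN
  -- The work terms used are at most 3Z, the case of three summands being `U`. As Z ≥ 2, the cube is
  -- at least 4Z.
  have hZpow : ∀ {V}, V ≤ 3 * Z → V ≤ Z ^ 3 := fun {V} h => by
    have hZ2 : 2 ≤ Z := by omega
    have : Z * (2 * 2) ≤ Z * (Z * Z) := by gcongr
    have e : Z ^ 3 = Z * (Z * Z) := by ring
    omega
  set alphas := (alphaPowers K ω.α D ω.q n).val with halphas
  set im := parFor m (List.range mu) (imageStep K f D ω alphas) with him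
  set L0 := im.val.flatten with hL0
  set srt := parSort K m (fun t : Image => [t.coeff]) Image.size L0 with hsrt
  set L := srt.val with hL
  set Dn := (pow K D n).val with hDn
  set tm := parFor m (List.range L.length) (termStep K n D mu Dn ω.q ω.α L) with htm
  set F := tm.val.flatten with hF
  set out := parSort K m (fun t : ℤ × List ℕ => t.2) termSize F with hout
  have htime : (sparseInterp K m f T D k ℓ ω).time = (pay K (bits ω.q)).time +
      ((pay K (bits ω.α)).time + ((alphaPowers K ω.α D ω.q n).time + ((mul K k T).time +
      ((pay K (bits ℓ + bits n + bits D + bits lam)).time + (im.time + (srt.time +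
      ((pow K D n).time + (tm.time + out.time)))))))) := rfl
  set G := K.overhead Λ with hG
  set V := n * bD * bQ with hV
  set U := n + bD + lam * bQ with hU
  have hcharge : ∀ {V w}, V ≤ 3 * Z → w ≤ 6000 * Λ ^ 3 * V → K.charge w ≤ G * V :=
    fun hV hw => K.charge_le_overhead hZ1 (hZpow hV) hw
  -- initialization
  have h0 : (pay K (bits ω.q)).time + ((pay K (bits ω.α)).time +
      ((alphaPowers K ω.α D ω.q n).time + ((mul K k T).time +
      (pay K (bits ℓ + bits n + bits D + bits lam)).time))) ≤ G * V := by
    refine le_trans ?_ (hcharge (by omega) (initialWork_le hn hΛ1 hbDb hbq hbα (by omega)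
      (by omega) (hbits hkZ) (hbits hTZ) (hbits hℓZ) (hbits hnZ) (hbits (x := lam) (by omega))))
    simp only [pay_time, mul_time]
    exact K.add_le_charge le_rfl (K.add_le_charge le_rfl (K.add_le_charge
      (alphaPowers_time_le K hq0 hα) (K.add_le_charge le_rfl le_rfl le_rfl) le_rfl) le_rfl)
      (by omega)
  -- images
  have hstep := fun i => imageStep_spec K f D ω alphas i hq0 (hω.p_prime i).pos
  have h1 : m * im.time ≤ (mu + m) * (G * U) := by
    have hle : ∀ t ∈ (List.range mu).map fun i => (imageStep K f D ω alphas i).time,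
        t ≤ G * U := by
      intro t ht
      obtain ⟨i, hi, rfl⟩ := List.mem_map.1 ht
      have hi' := List.mem_range.1 hi
      have hpi := hω.p_upper i
      exact (hstep i).2.2.trans (hcharge (by omega) (imageWork_le hn hΛ1 hbDb hbq (by omega)
        (by omega) (by omega) rfl (hbits (by omega)) hpi (hbits (by omega))))
    have g1 := mul_makespan_le hm _ _ hle
    have g2 := List.sum_le_card_nsmul _ _ hle
    rw [List.length_map, List.length_range, smul_eq_mul] at g2
    rw [add_mul]
    exact g1.trans (Nat.add_le_add_right g2 _)
  have hL0len : L0.length ≤ mu * (2 * lam) := by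
    rw [hL0, List.length_flatten]
    refine (List.sum_le_card_nsmul _ (2 * lam) ?_).trans (by simp [him, parFor])
    intro x hx
    obtain ⟨l, hl, rfl⟩ := List.mem_map.1 hx
    obtain ⟨i, hi, rfl⟩ := List.mem_map.1 hl
    exact (hstep i).1.trans (hω.p_upper i)
  have hL0mem : ∀ t ∈ L0, t.Bounded ω.q (2 * lam) := by
    intro t ht
    obtain ⟨l, hl, ht⟩ := List.mem_flatten.1 ht
    obtain ⟨i, hi, rfl⟩ := List.mem_map.1 hl
    obtain ⟨a1, a2, a3⟩ := (hstep i).2.1 t ht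
    exact ⟨a1, a2, a3.trans (hω.p_upper i)⟩
  -- first sort
  obtain ⟨s1, s2, s3, s4⟩ := parSort_spec K hm (fun t : Image => [t.coeff]) Image.size L0
    (bits ω.q + 2 * bits (2 * lam)) (fun t ht => (hL0mem t ht).size_le) (fun t _ => by
      have e1 := one_le_bits t.expo
      simp only [bitsList, Image.size, List.map_cons, List.map_nil, List.sum_cons, List.sum_nil]
      omega)
  rw [← hsrt, ← hL] at s1 s2 s3
  rw [← hsrt] at s4
  have hLmem : ∀ t ∈ L, t.Bounded ω.q (2 * lam) := fun t ht => hL0mem t (s2 t ht)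
  have hLsort : ∀ i j, i ≤ j → j < L.length → (entry L i).coeff ≤ (entry L j).coeff :=
    fun i j hij hj => le_of_singleton_le (s3 i j hij (by rwa [← s1]))
  have hNZ : L0.length ≤ Z := hL0len.trans hN
  have hbN : bits L0.length ≤ 2 * Λ := hbits hNZ
  have h2 : m * srt.time ≤ 2 * Λ * ((L0.length + 2 * m) * (G * bQ)) := by
    refine s4.trans ?_
    gcongr
    exact hcharge (by omega) (imageSortWork_le hΛ1 hbq (by omega) hbN hbP)
  -- powers of the base
  obtain ⟨p1, p2⟩ := pow_spec K (show 1 ≤ D by omega) n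
  have h3 : (pow K D n).time ≤ G * V :=
    p2.trans (hcharge (by omega) (powerWork_le hn hΛ1 (by omega) (by omega) (hbits hnZ)))
  have hDnb : bits Dn ≤ 2 * n * D.size + 2 := Nat.succ_le_succ p1
  -- terms
  set H := ((Finset.range L.length).filter (IsHeavy K L mu)).card with hH
  -- H · mu ≤ 2|L| ≤ 4 · lam · mu, and the positive number mu cancels.
  have hHlam : H ≤ 4 * lam := by
    have hcard := card_isHeavy_le K hLmem hLsort mu
    refine Nat.le_of_mul_le_mul_right (c := mu) ?_ hmu1
    calc H * mu ≤ 2 * L.length := hcard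
      _ ≤ 2 * (mu * (2 * lam)) := by rw [s1]; gcongr
      _ = 4 * lam * mu := by ring
  have hHN : H ≤ L.length := (Finset.card_filter_le _ _).trans (by simp)
  have hbL : bits L.length ≤ 2 * Λ := by rwa [s1]
  have hlight : K.charge (40 * (bits L.length * (bits L.length +
      (bits ω.q + 2 * bits (2 * lam)))) + bits mu) ≤ G * bQ :=
    hcharge (by omega) (lightWork_le hΛ1 hbq (by omega) hbL hbP (hbits hmuZ))
  have hheavy : K.charge (runStepWork n D L.length ω.q (2 * lam) (2 * n * D.size + 2)) ≤ G * V :=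
    hcharge (by omega) (runStepWork_le hn hΛ1 hbDb hbq (by omega) (by omega) hbL hbP
      (hbits hnZ) (hbits hMZ))
  have hterm := fun s hs => termStep_spec K (mu := mu) (s := s) hLmem hLsort hn
    (show 1 ≤ D by omega) hα hq0 hDnb hs
  have h4 : m * tm.time ≤ L0.length * (G * bQ) + H * (G * V) + m * (G * bQ + G * V) := by
    refine (mul_makespan_le hm _ (G * bQ + G * V) ?_).trans (Nat.add_le_add_right
      ((sum_termStep_time_le K hLmem hLsort hn (show 1 ≤ D by omega) hα hq0 hDnb).trans ?_) _)
    · intro t ht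
      obtain ⟨s, hs, rfl⟩ := List.mem_map.1 ht
      refine (hterm s (List.mem_range.1 hs)).2.2.trans (Nat.add_le_add hlight ?_)
      split
      · exact hheavy
      · exact Nat.zero_le _
    · rw [← hH, ← s1]
      gcongr
  -- second sort
  have hFlen : F.length ≤ H :=
    length_terms_le K hLmem hLsort hn (show 1 ≤ D by omega) hα hq0 hDnb
  have hFmem : ∀ t ∈ F, termSize t ≤ bits ω.q + n * bits D + 2 ∧ bitsList t.2 ≤ termSize t := by
    intro t ht
    obtain ⟨l, hl, ht⟩ := List.mem_flatten.1 ht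
    obtain ⟨s, hs, rfl⟩ := List.mem_map.1 hl
    exact (hterm s (List.mem_range.1 hs)).2.1 t ht
  obtain ⟨-, -, -, o4⟩ := parSort_spec K hm (fun t : ℤ × List ℕ => t.2) termSize F
    (bits ω.q + n * bits D + 2) (fun t ht => (hFmem t ht).1) (fun t ht => (hFmem t ht).2)
  have hbF : bits F.length ≤ 2 * Λ := hbits (by omega)
  have h5 : m * out.time ≤ 2 * Λ * ((H + 2 * m) * (G * V)) := by
    refine o4.trans ?_
    gcongr
    exact hcharge (by omega) (termSortWork_le hn hΛ1 hbDb hbq (by omega) (by omega) hbF)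
  -- total
  set W := parallelWork n lam D ℓ Q with hW
  have w1 : mu * U ≤ W := Nat.mul_le_mul_right _ hmu2
  -- Reconstructing all heavy terms fits into the parallel work, with the factor ℓ to spare.
  have w2 : V * lam ≤ W := by
    calc V * lam ≤ V * lam * ℓ := Nat.le_mul_of_pos_right _ hℓ
      _ = ℓ * n * bD * (lam * bQ) := by rw [hV]; ring
      _ ≤ W := Nat.mul_le_mul_left _ (Nat.le_add_left _ _)
  have w3 : L0.length * bQ ≤ 2 * W := by
    calc L0.length * bQ ≤ ℓ * n * bD * (2 * lam) * bQ := by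
          gcongr
          exact hL0len.trans (by gcongr)
      _ = 2 * (ℓ * n * bD * (lam * bQ)) := by ring
      _ ≤ 2 * W := by
        gcongr
        exact Nat.mul_le_mul_left _ (Nat.le_add_left _ _)
  have w4 : H * V ≤ 4 * W := by
    calc H * V ≤ 4 * lam * V := by gcongr
      _ = 4 * (V * lam) := by ring
      _ ≤ 4 * W := by gcongr
  have w5 : bQ ≤ V := Nat.le_mul_of_pos_left _ (Nat.mul_pos hn (by omega))
  have w6 : n ≤ V := (Nat.le_mul_of_pos_right n (show 0 < bD * bQ by positivity)).trans
    (by rw [hV, mul_assoc])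
  have w7 : bD ≤ V := (Nat.le_mul_of_pos_right bD (show 0 < n * bQ by positivity)).trans
    (le_of_eq (by rw [hV]; ring))
  have v0 : m * (G * V) = G * (m * V) := by ring
  -- The longest image iteration is serial work: `n` and `bD` are at most `V`, and `lam * bQ` is the
  -- second summand of `serialWork`.
  have v1 : (mu + m) * (G * U) ≤ G * (W + (2 * (m * V) + m * (lam * bQ))) := by
    calc (mu + m) * (G * U) = G * (mu * U + m * U) := by ring
      _ ≤ G * (W + m * (2 * V + lam * bQ)) := by
        gcongr
        omega
      _ = _ := by ring
  have v2 : 2 * Λ * ((L0.length + 2 * m) * (G * bQ)) ≤ Λ * (G * (4 * W + 4 * (m * V))) := by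
    calc _ = Λ * (G * (2 * (L0.length * bQ) + 4 * (m * bQ))) := by ring
      _ ≤ Λ * (G * (2 * (2 * W) + 4 * (m * V))) := by gcongr
      _ = _ := by ring
  have v4 : L0.length * (G * bQ) + H * (G * V) + m * (G * bQ + G * V) ≤
      G * (6 * W + 2 * (m * V)) := by
    calc _ = G * (L0.length * bQ + H * V + m * bQ + m * V) := by ring
      _ ≤ G * (2 * W + 4 * W + m * V + m * V) := by gcongr
      _ = _ := by ring
  have v5 : 2 * Λ * ((H + 2 * m) * (G * V)) ≤ Λ * (G * (8 * W + 4 * (m * V))) := by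
    calc _ = Λ * (G * (2 * (H * V) + 4 * (m * V))) := by ring
      _ ≤ Λ * (G * (2 * (4 * W) + 4 * (m * V))) := by gcongr
      _ = _ := by ring
  have e : m * serialWork n lam D Q = m * V + m * (lam * bQ) := by
    rw [serialWork, mul_add]
  calc m * (sparseInterp K m f T D k ℓ ω).time
      = m * ((pay K (bits ω.q)).time + ((pay K (bits ω.α)).time +
      ((alphaPowers K ω.α D ω.q n).time + ((mul K k T).time +
      (pay K (bits ℓ + bits n + bits D + bits lam)).time)))) + m * im.time + m * srt.time +
      m * (pow K D n).time + m * tm.time + m * out.time := by rw [htime]; ring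
    _ ≤ m * (G * V) + G * (W + (2 * (m * V) + m * (lam * bQ))) + Λ * (G * (4 * W + 4 * (m * V))) +
      m * (G * V) + G * (6 * W + 2 * (m * V)) + Λ * (G * (8 * W + 4 * (m * V))) := by
        refine Nat.add_le_add (Nat.add_le_add (Nat.add_le_add (Nat.add_le_add (Nat.add_le_add
          (Nat.mul_le_mul_left _ h0) (h1.trans v1)) (h2.trans v2)) (Nat.mul_le_mul_left _ h3))
          (h4.trans v4)) (h5.trans v5)
    _ ≤ 40 * Λ * G * (m * serialWork n lam D Q + W) := by
      rw [e, v0]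
      generalize m * V = X
      generalize m * (lam * bQ) = R
      clear_value Λ G W
      obtain ⟨Λ, rfl⟩ := pos_exists_succ hΛ1
      ring_nf
      omega

/-! ### The bound in terms of logarithms -/

/-- With |x| = s + 1, both s · log 2 and log 2 are at most log x, and 2/log 2 < 3. -/
theorem size_le_three_mul_log {x : ℕ} (hx : 2 ≤ x) : (x.size : ℝ) ≤ 3 * Real.log x := by
  obtain ⟨s, hs⟩ : ∃ s, x.size = s + 1 :=
    ⟨x.size - 1, by have := Nat.size_pos.2 (show 0 < x by omega); omega⟩
  have h1 : 2 ^ s ≤ x := Nat.lt_size.1 (show s < x.size by omega)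
  have h2 : (s : ℝ) * Real.log 2 ≤ Real.log x := by
    rw [← Real.log_pow]
    exact Real.log_le_log (by positivity) (by exact_mod_cast h1)
  have h3 : Real.log 2 ≤ Real.log x := Real.log_le_log (by norm_num) (by exact_mod_cast hx)
  have h4 := Real.log_two_gt_d9
  have h5 : (0 : ℝ) ≤ s := Nat.cast_nonneg s
  rw [hs]
  push_cast
  nlinarith

theorem size_le_log {x : ℕ} (hx : 1 ≤ x) : (x.size : ℝ) ≤ 2 * Real.log x + 1 := by
  obtain ⟨s, hs⟩ : ∃ s, x.size = s + 1 :=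
    ⟨x.size - 1, by have := Nat.size_pos.2 (show 0 < x by omega); omega⟩
  have h1 : 2 ^ s ≤ x := Nat.lt_size.1 (show s < x.size by omega)
  have h2 : (s : ℝ) * Real.log 2 ≤ Real.log x := by
    rw [← Real.log_pow]
    exact Real.log_le_log (by positivity) (by exact_mod_cast h1)
  have h4 := Real.log_two_gt_d9
  have h5 : (0 : ℝ) ≤ s := Nat.cast_nonneg s
  rw [hs]
  push_cast
  nlinarith

section Cost

variable {n T D k ℓ Q m : ℕ}

/-- At most two bit lengths are multiplied in a term, and each costs a factor 3 against the
logarithm. -/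
theorem serialWork_add_le_costBound (hD : 2 ≤ D) (hℓ : 1 ≤ ℓ) (hQ : 2 ≤ Q) :
    (serialWork n (k * T) D Q : ℝ) + parallelWork n (k * T) D ℓ Q / m ≤
      9 * costBound n T D k ℓ Q m := by
  have hbD := size_le_three_mul_log hD
  have hbQ := size_le_three_mul_log hQ
  have hlD : 0 ≤ Real.log D := Real.log_natCast_nonneg D
  have hlQ : 0 ≤ Real.log Q := Real.log_natCast_nonneg Q
  have hlℓ : 0 ≤ Real.log ℓ := Real.log_natCast_nonneg ℓ
  have h1 : (serialWork n (k * T) D Q : ℝ) ≤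
      9 * (n * Real.log D * Real.log Q + k * T * Real.log Q) := by
    simp only [serialWork]
    push_cast
    calc (n : ℝ) * D.size * Q.size + k * T * Q.size
        ≤ n * (3 * Real.log D) * (3 * Real.log Q) + k * T * (3 * Real.log Q) := by gcongr
      _ ≤ _ := by nlinarith [show (0 : ℝ) ≤ k * T * Real.log Q by positivity]
  have h2 : (parallelWork n (k * T) D ℓ Q : ℝ) ≤
      9 * (ℓ * n * Real.log D * (n + Real.log D + k * T * Real.log Q)) := by
    simp only [parallelWork]
    push_cast
    calc (ℓ : ℝ) * n * D.size * (n + D.size + k * T * Q.size)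
        ≤ ℓ * n * (3 * Real.log D) * (3 * n + 3 * Real.log D + k * T * (3 * Real.log Q)) := by
          gcongr
          linarith [Nat.cast_nonneg (α := ℝ) n]
      _ = _ := by ring
  have h3 : (parallelWork n (k * T) D ℓ Q : ℝ) / m ≤
      9 * (1 / (m : ℝ) * ℓ * n * Real.log D * (n + Real.log D + k * T * Real.log Q)) := by
    calc (parallelWork n (k * T) D ℓ Q : ℝ) / m
        ≤ 9 * (ℓ * n * Real.log D * (n + Real.log D + k * T * Real.log Q)) / m := by gcongr
      _ = _ := by ring
  unfold costBound
  linarith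

theorem one_le_costBound (hkT : 2 ≤ k * T) (hQ : 2 ≤ Q) :
    1 ≤ costBound n T D k ℓ Q m := by
  have h4 := Real.log_two_gt_d9
  have hlD : 0 ≤ Real.log D := Real.log_natCast_nonneg D
  have hlQ' : Real.log 2 ≤ Real.log Q := Real.log_le_log (by norm_num) (by exact_mod_cast hQ)
  have hlQ : 0 ≤ Real.log Q := Real.log_natCast_nonneg Q
  have hlℓ : 0 ≤ Real.log ℓ := Real.log_natCast_nonneg ℓ
  have h1 : (2 : ℝ) ≤ k * T := by exact_mod_cast hkT
  have h2 : (0 : ℝ) ≤ n * Real.log D * Real.log Q := by positivity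
  have h3 : (0 : ℝ) ≤ 1 / (m : ℝ) * ℓ * n * Real.log D *
    (n + Real.log D + k * T * Real.log Q) := by positivity
  unfold costBound
  nlinarith

/-- Each factor of the product other than ℓ is bounded by the serial work. The factor ℓ alone may
exceed every power of φ when there are many processors, and this is what min(m, ℓ) accounts for. -/
theorem size_le_log_costBound (hn : 1 ≤ n) (hD : 2 ≤ D) (hkT : 2 ≤ k * T) (hℓ : 1 ≤ ℓ)
    (hQ : 2 ≤ Q) (hm : 1 ≤ m) :
    ((n * (k * T) * D.size * Q.size * ℓ).size : ℝ) ≤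
      80 * Real.log (costBound n T D k ℓ Q m + min (m : ℝ) ℓ) := by
  set φ := costBound n T D k ℓ Q m with hφ
  set μ := min (m : ℝ) ℓ with hμ
  have hm' : (1 : ℝ) ≤ m := by exact_mod_cast hm
  have hℓ' : (1 : ℝ) ≤ ℓ := by exact_mod_cast hℓ
  have hφ1 : 1 ≤ φ := one_le_costBound hkT hQ
  have hμ1 : 1 ≤ μ := le_min hm' hℓ'
  have hD1 : 0 < D.size := Nat.size_pos.2 (by omega)
  have hQ1 : 0 < Q.size := Nat.size_pos.2 (by omega)
  have hA := serialWork_add_le_costBound (n := n) (k := k) (T := T) (m := m) hD hℓ hQ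
  rw [← hφ] at hA
  have hS0 : (0 : ℝ) ≤ serialWork n (k * T) D Q := Nat.cast_nonneg _
  have hP0 : (0 : ℝ) ≤ parallelWork n (k * T) D ℓ Q / m := by positivity
  set g := Real.log (φ + μ) with hg
  have hg1 : 1 / 2 ≤ g := by
    have h1 : Real.log 2 ≤ g := Real.log_le_log (by norm_num) (by linarith)
    linarith [Real.log_two_gt_d9]
  have hlog9 : Real.log 9 ≤ 3 := by
    rw [Real.log_le_iff_le_exp (by norm_num)]
    have h1 := Real.add_one_le_exp (1 : ℝ)
    have h2 := Real.exp_one_gt_d9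
    have h3 : Real.exp 3 = Real.exp 1 ^ 3 := by rw [← Real.exp_nat_mul]; norm_num
    rw [h3]
    nlinarith [pow_le_pow_left₀ (by norm_num : (0 : ℝ) ≤ 2.7) (by linarith : 2.7 ≤ Real.exp 1) 3]
  have hsmall : ∀ x : ℕ, 1 ≤ x → x ≤ serialWork n (k * T) D Q → Real.log x ≤ 3 + g := by
    intro x hx hxA
    have hx' : (0 : ℝ) < x := by exact_mod_cast hx
    have hxA' : (x : ℝ) ≤ serialWork n (k * T) D Q := by exact_mod_cast hxA
    calc Real.log x ≤ Real.log (9 * (φ + μ)) := Real.log_le_log hx' (by linarith)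
      _ = Real.log 9 + g := Real.log_mul (by norm_num) (by linarith)
      _ ≤ 3 + g := by linarith
  have hS : serialWork n (k * T) D Q = n * D.size * Q.size + (k * T) * Q.size := rfl
  have hlD := hsmall D.size hD1 (by
    rw [hS]
    have : 1 * D.size * 1 ≤ n * D.size * Q.size := by gcongr <;> omega
    omega)
  have hln := hsmall n hn (by
    rw [hS]
    have : n * 1 * 1 ≤ n * D.size * Q.size := by gcongr <;> omega
    omega)
  have hlQ := hsmall Q.size hQ1 (by
    rw [hS]
    have : 1 * 1 * Q.size ≤ n * D.size * Q.size := by gcongr <;> omega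
    omega)
  have hllam := hsmall (k * T) (by omega) (by
    rw [hS]
    have : k * T * 1 ≤ k * T * Q.size := by gcongr; omega
    omega)
  have hlℓ : Real.log ℓ ≤ 3 + 2 * g := by
    rcases le_total (m : ℝ) ℓ with h | h
    · have hμm : μ = m := min_eq_left h
      have h1 : (ℓ : ℝ) ≤ parallelWork n (k * T) D ℓ Q := by
        have : ℓ * 1 * 1 * 1 ≤ parallelWork n (k * T) D ℓ Q := by
          unfold parallelWork
          gcongr <;> omega
        exact_mod_cast (by omega : ℓ ≤ parallelWork n (k * T) D ℓ Q)
      have h2 : (ℓ : ℝ) / m ≤ 9 * φ := by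
        have : (ℓ : ℝ) / m ≤ parallelWork n (k * T) D ℓ Q / m := by gcongr
        linarith
      rw [div_le_iff₀ (by linarith)] at h2
      -- Here ℓ ≤ 9φm with m = μ, and φμ ≤ (φ + μ)².
      calc Real.log ℓ ≤ Real.log (9 * (φ + μ) ^ 2) := by
            refine Real.log_le_log (by linarith) ?_
            rw [hμm] at hμ1 ⊢
            nlinarith
        _ = Real.log 9 + 2 * g := by
            rw [Real.log_mul (by norm_num) (by positivity), Real.log_pow]
            push_cast
            rfl
        _ ≤ 3 + 2 * g := by linarith
    · have hμℓ : μ = ℓ := min_eq_right h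
      have : Real.log ℓ ≤ g := Real.log_le_log (by linarith) (by linarith)
      linarith
  have hZ : 1 ≤ n * (k * T) * D.size * Q.size * ℓ := by
    have : 0 < k * T := by omega
    have : 0 < n * (k * T) * D.size * Q.size * ℓ := by positivity
    exact this
  have hlogZ : Real.log ((n * (k * T) * D.size * Q.size * ℓ : ℕ) : ℝ) =
      Real.log n + Real.log ((k * T : ℕ) : ℝ) + Real.log D.size + Real.log Q.size +
        Real.log ℓ := by
    have a1 : (n : ℝ) ≠ 0 := by positivity
    have a2 : ((k * T : ℕ) : ℝ) ≠ 0 := by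
      have : k * T ≠ 0 := by omega
      exact_mod_cast this
    have a3 : (D.size : ℝ) ≠ 0 := by positivity
    have a4 : (Q.size : ℝ) ≠ 0 := by positivity
    have a5 : (ℓ : ℝ) ≠ 0 := by positivity
    rw [Nat.cast_mul, Nat.cast_mul, Nat.cast_mul, Nat.cast_mul n,
      Real.log_mul (by positivity) a5, Real.log_mul (by positivity) a4,
      Real.log_mul (by positivity) a3, Real.log_mul a1 a2]
  -- Four logarithms of at most 3 + g and one of at most 3 + 2g give the length bound 2(15 + 6g) + 1
  -- = 31 + 12g, which is at most 74g because g ≥ 1/2.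
  have := size_le_log hZ
  rw [hlogZ] at this
  linarith

end Cost

end SparseInterp

theorem theorem1 (K : SparseInterp.Rate) :
    ∃ (C : ℝ) (c : ℕ),
      ∀ (n T D k ℓ Q m : ℕ), 1 ≤ n → 2 ≤ D → 2 ≤ k * T → 1 ≤ ℓ → 2 ≤ Q → 1 ≤ m →
      ∀ (f : MvPolynomial (Fin n) ℤ), f.support.card ≤ T → (∀ i, f.degreeOf i < D) →
      ∀ (ω : SparseInterp.Choices), ω.Valid Q (k * T) →
        ((SparseInterp.sparseInterp K m f T D k ℓ ω).time : ℝ) ≤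
          C * SparseInterp.costBound n T D k ℓ Q m *
            (Real.log (SparseInterp.costBound n T D k ℓ Q m + min (m : ℝ) (ℓ : ℝ))) ^ c := by
  -- In the exponent, `K.power` comes from the charges, 3 from the factor Λ³ in the work estimates,
  -- and 1 from the rounds of the sorts. Each such logarithm costs a factor 80, and the passage from
  -- bit lengths to φ costs 9.
  refine ⟨40 * (K.factor * 6000 * 6010 ^ K.power) * 80 ^ (K.power + 4) * 9, K.power + 4, ?_⟩
  intro n T D k ℓ Q m hn hD hkT hℓ hQ hm f _ _ ω hω
  have hmain := SparseInterp.mul_sparseInterp_time_le K hn hD hkT hℓ hQ hm f ω hω rfl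
  have hsize := SparseInterp.size_le_log_costBound hn hD hkT hℓ hQ hm
  have hwork := SparseInterp.serialWork_add_le_costBound (n := n) (k := k) (T := T) (m := m)
    hD hℓ hQ
  have hφ := SparseInterp.one_le_costBound (n := n) (D := D) (ℓ := ℓ) (m := m) hkT hQ
  set t := (SparseInterp.sparseInterp K m f T D k ℓ ω).time
  set s := (n * (k * T) * D.size * Q.size * ℓ).size
  set φ := SparseInterp.costBound n T D k ℓ Q m
  set g := Real.log (φ + min (m : ℝ) ℓ)
  set A := SparseInterp.serialWork n (k * T) D Q
  set W := SparseInterp.parallelWork n (k * T) D ℓ Q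
  have hm0 : (0 : ℝ) < m := by exact_mod_cast hm
  have hg0 : 0 ≤ g := by linarith [Nat.cast_nonneg (α := ℝ) s]
  have hcast : (m : ℝ) * t ≤ 40 * s * K.overhead s * (m * A + W) := by exact_mod_cast hmain
  have htime : (t : ℝ) ≤ 40 * s * K.overhead s * (A + W / m) := by
    refine le_of_mul_le_mul_left (hcast.trans (le_of_eq ?_)) hm0
    field_simp
  have hover : (K.overhead s : ℝ) = K.factor * 6000 * 6010 ^ K.power * (s : ℝ) ^ (K.power + 3) := by
    unfold SparseInterp.Rate.overhead
    push_cast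
    rw [mul_pow]
    ring
  calc (t : ℝ) ≤ 40 * s * K.overhead s * (A + W / m) := htime
    _ = 40 * (K.factor * 6000 * 6010 ^ K.power) * (s : ℝ) ^ (K.power + 4) * (A + W / m) := by
      rw [hover]
      ring
    _ ≤ 40 * (K.factor * 6000 * 6010 ^ K.power) * (80 * g) ^ (K.power + 4) * (9 * φ) := by
      gcongr
    _ = _ := by
      rw [mul_pow]
      ring
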